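/- Let $\mathbb{D}$ be the open unit disc and $H^2(\mathbb{D})$ the Hardy space of holomorphic functions $f$ on $\mathbb{D}$ with $$\|f\|=\sup_{0\le r<1}\left(\frac1{2\pi}\int_0^{2\pi}|f(re^{i\theta})|^2\,d\theta\right)^{1/2}<\infty .$$ A bounded linear operator $U$ on a Banach space $\mathcal{B}$ is called universal for $\mathcal{B}$ if for every bounded linear operator $T$ on $\mathcal{B}$ there are a constant $\alpha\neq 0$ and a closed subspace $\mathcal{M}$ invariant under $U$ such that the restriction $U|_{\mathcal{M}}$ is similar to $\alpha T$. Let $\phi(z)=\frac{Az+B}{Cz+D}$, with $A,B,C,D\in\mathbb{C}$ and $AD-BC\neq 0$, be a linear fractional map with $\phi(\mathbb{D})\subset\mathbb{D}$ that is a hyperbolic non-automorphism: it has exactly two fixed points in $\mathbb{C}\cup\{\infty\}$, one of them, $\zeta$, on the unit circle, and the other one outside the closed unit disc $\overline{\mathbb{D}}$ (possibly at $\infty$). Let $a:=\phi'(\zeta)\in(0,1)$. Then the composition operator $C_\phi f=f\circ\phi$ is a bounded operator on $H^2(\mathbb{D})$, and for every $\lambda\in\mathbb{C}$ with $0<|\lambda|<a^{-1/2}$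 the operator $C_\phi-\lambda I$ is universal for $H^2(\mathbb{D})$. -/

import Mathlib

/-! ### The Hardy space of the unit disc -/

noncomputable section

namespace HardyDisc

open MeasureTheory

/-- The quadratic integral mean `(1/(2π) ∫₀^{2π} |f(r e^{iθ})|² dθ)^{1/2}` over the circle of
radius `r` about `0`. -/
def integralMean (f : ℂ → ℂ) (r : ℝ) : ℝ :=
  Real.sqrt (Real.circleAverage (fun z => ‖f z‖ ^ 2) 0 r)

/-- The set of the integral means over all radii `0 ≤ r < 1`. -/
def integralMeans (f : ℂ → ℂ) : Set ℝ :=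
  integralMean f '' Set.Ico 0 1

/-- Membership in `H²(𝔻)`. A function on the unit disc is represented by its extension by `0`
to `ℂ`, so that two elements are equal iff they agree on the disc. -/
structure IsHardy (f : ℂ → ℂ) : Prop where
  holo : DifferentiableOn ℂ f (Metric.ball 0 1)
  eq_zero : ∀ z, z ∉ Metric.ball (0 : ℂ) 1 → f z = 0
  bdd : BddAbove (integralMeans f)

theorem integralMean_nonneg (f : ℂ → ℂ) (r : ℝ) : 0 ≤ integralMean f r :=
  Real.sqrt_nonneg _

theorem continuous_circle {f : ℂ → ℂ} (hf : DifferentiableOn ℂ f (Metric.ball 0 1))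
    {r : ℝ} (hr : r ∈ Set.Ico (0 : ℝ) 1) : Continuous (fun θ : ℝ => f (circleMap 0 r θ)) := by
  refine hf.continuousOn.comp_continuous (continuous_circleMap 0 r) fun θ => ?_
  rw [mem_ball_zero_iff, norm_circleMap_zero, abs_of_nonneg hr.1]
  exact hr.2

theorem memLp_circle {f : ℂ → ℂ} (hf : DifferentiableOn ℂ f (Metric.ball 0 1))
    {r : ℝ} (hr : r ∈ Set.Ico (0 : ℝ) 1) :
    MemLp (fun θ : ℝ => f (circleMap 0 r θ)) 2
      (volume.restrict (Set.Ioc 0 (2 * Real.pi))) := by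
  have hc := continuous_circle hf hr
  obtain ⟨B, hB⟩ := (isCompact_Icc (a := (0 : ℝ)) (b := 2 * Real.pi)).exists_bound_of_continuousOn
    hc.continuousOn
  exact MemLp.of_bound hc.aestronglyMeasurable B
    (ae_restrict_of_forall_mem measurableSet_Ioc fun θ hθ => hB θ (Set.Ioc_subset_Icc_self hθ))

theorem integralMean_eq {f : ℂ → ℂ} (hf : DifferentiableOn ℂ f (Metric.ball 0 1))
    {r : ℝ} (hr : r ∈ Set.Ico (0 : ℝ) 1) :
    integralMean f r = Real.sqrt (2 * Real.pi)⁻¹ *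
      (eLpNorm (fun θ : ℝ => f (circleMap 0 r θ)) 2
        (volume.restrict (Set.Ioc 0 (2 * Real.pi)))).toReal := by
  rw [(memLp_circle hf hr).eLpNorm_eq_integral_rpow_norm (by norm_num) (by norm_num),
    ENNReal.toReal_ofReal (by positivity), integralMean, Real.circleAverage_def,
    intervalIntegral.integral_of_le (by positivity), smul_eq_mul, Real.sqrt_mul (by positivity),
    Real.sqrt_eq_rpow (∫ _ in _, _)]
  norm_num

theorem integralMean_add_le {f g : ℂ → ℂ} (hf : DifferentiableOn ℂ f (Metric.ball 0 1))
    (hg : DifferentiableOn ℂ g (Metric.ball 0 1)) {r : ℝ} (hr : r ∈ Set.Ico (0 : ℝ) 1) :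
    integralMean (f + g) r ≤ integralMean f r + integralMean g r := by
  rw [integralMean_eq (hf.add hg) hr, integralMean_eq hf hr, integralMean_eq hg hr, ← mul_add,
    ← ENNReal.toReal_add (memLp_circle hf hr).2.ne (memLp_circle hg hr).2.ne]
  refine mul_le_mul_of_nonneg_left (ENNReal.toReal_mono ?_ ?_) (Real.sqrt_nonneg _)
  · exact (ENNReal.add_lt_top.2 ⟨(memLp_circle hf hr).2, (memLp_circle hg hr).2⟩).ne
  · exact eLpNorm_add_le (memLp_circle hf hr).1 (memLp_circle hg hr).1 (by norm_num)

theorem integralMean_smul (c : ℂ) (f : ℂ → ℂ) (r : ℝ) :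
    integralMean (c • f) r = ‖c‖ * integralMean f r := by
  have h : (fun z => ‖(c • f) z‖ ^ 2) = (‖c‖ ^ 2) • (fun z => ‖f z‖ ^ 2) := by
    ext z
    simp [mul_pow]
  rw [integralMean, integralMean, h, Real.circleAverage_smul, smul_eq_mul,
    Real.sqrt_mul (by positivity), Real.sqrt_sq (norm_nonneg c)]

theorem integralMean_zero (r : ℝ) : integralMean 0 r = 0 := by
  simpa using integralMean_smul 0 0 r

theorem integralMean_eq_zero {f : ℂ → ℂ} (hf : DifferentiableOn ℂ f (Metric.ball 0 1))
    (h : ∀ r ∈ Set.Ico (0 : ℝ) 1, integralMean f r = 0) {z : ℂ}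
    (hz : z ∈ Metric.ball (0 : ℂ) 1) : f z = 0 := by
  by_contra hne
  have hr : ‖z‖ ∈ Set.Ico (0 : ℝ) 1 := ⟨norm_nonneg z, mem_ball_zero_iff.1 hz⟩
  have hmem : z ∈ circleMap 0 ‖z‖ '' Set.Ioc 0 (2 * Real.pi) := by
    rw [image_circleMap_Ioc]
    simp
  obtain ⟨θ, hθ, hθz⟩ := hmem
  have hpos : 0 < ∫ t in (0 : ℝ)..(2 * Real.pi), ‖f (circleMap 0 ‖z‖ t)‖ ^ 2 := by
    refine intervalIntegral.integral_pos (by positivity)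
      ((continuous_circle hf hr).norm.pow 2).continuousOn (fun _ _ => by positivity)
      ⟨θ, Set.Ioc_subset_Icc_self hθ, ?_⟩
    rw [hθz]
    positivity
  have h0 := h _ hr
  rw [integralMean, Real.circleAverage_def, smul_eq_mul, Real.sqrt_eq_zero (by positivity)] at h0
  have : (2 * Real.pi)⁻¹ ≠ 0 := by positivity
  rcases mul_eq_zero.1 h0 with h1 | h1
  · exact this h1
  · exact hpos.ne' h1

/-- `H²(𝔻)` as a linear subspace of the functions. -/
def hardySubmodule : Submodule ℂ (ℂ → ℂ) where
  carrier := {f | IsHardy f}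
  zero_mem' :=
    ⟨differentiableOn_const 0, fun _ _ => rfl, ⟨0, by
      rintro _ ⟨r, -, rfl⟩
      exact (integralMean_zero r).le⟩⟩
  add_mem' := by
    rintro f g ⟨hf, hf0, ⟨a, ha⟩⟩ ⟨hg, hg0, ⟨b, hb⟩⟩
    refine ⟨hf.add hg, fun z hz => by simp [hf0 z hz, hg0 z hz], ⟨a + b, ?_⟩⟩
    rintro _ ⟨r, hr, rfl⟩
    exact (integralMean_add_le hf hg hr).trans (add_le_add (ha ⟨r, hr, rfl⟩) (hb ⟨r, hr, rfl⟩))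
  smul_mem' := by
    rintro c f ⟨hf, hf0, ⟨a, ha⟩⟩
    refine ⟨hf.const_smul c, fun z hz => by simp [hf0 z hz], ⟨‖c‖ * a, ?_⟩⟩
    rintro _ ⟨r, hr, rfl⟩
    rw [integralMean_smul]
    exact mul_le_mul_of_nonneg_left (ha ⟨r, hr, rfl⟩) (norm_nonneg c)

end HardyDisc

open HardyDisc in
/-- The Hardy space `H²(𝔻)`. (A type of its own, so that it carries the Hardy norm and not the
topology of pointwise convergence.) -/
def HardySpace : Type := hardySubmodule

namespace HardySpace

open HardyDisc

instance : AddCommGroup HardySpace := inferInstanceAs (AddCommGroup hardySubmodule)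

instance : Module ℂ HardySpace := inferInstanceAs (Module ℂ hardySubmodule)

instance : CoeFun HardySpace (fun _ => ℂ → ℂ) := ⟨fun f => f.1⟩

theorem isHardy (f : HardySpace) : IsHardy f := f.2

/-- The norm `sup_{0 ≤ r < 1} (1/(2π) ∫₀^{2π} |f(r e^{iθ})|² dθ)^{1/2}`. -/
instance : Norm HardySpace := ⟨fun f => sSup (integralMeans f)⟩

theorem norm_def (f : HardySpace) : ‖f‖ = sSup (integralMeans f) := rfl

theorem integralMean_le_norm (f : HardySpace) {r : ℝ} (hr : r ∈ Set.Ico (0 : ℝ) 1) :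
    integralMean f r ≤ ‖f‖ :=
  le_csSup f.isHardy.bdd ⟨r, hr, rfl⟩

theorem norm_le_of_forall (f : HardySpace) {B : ℝ}
    (h : ∀ r ∈ Set.Ico (0 : ℝ) 1, integralMean f r ≤ B) : ‖f‖ ≤ B := by
  refine csSup_le ⟨_, ⟨0, ⟨le_rfl, one_pos⟩, rfl⟩⟩ ?_
  rintro _ ⟨r, hr, rfl⟩
  exact h r hr

open scoped Pointwise in
theorem normedSpaceCore : NormedSpace.Core ℂ HardySpace where
  norm_nonneg f := (integralMean_nonneg f 0).trans (f.integralMean_le_norm ⟨le_rfl, one_pos⟩)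
  norm_smul c f := by
    have h : integralMeans (c • f : HardySpace) = ‖c‖ • integralMeans f := by
      ext x
      constructor
      · rintro ⟨r, hr, rfl⟩
        exact ⟨_, ⟨r, hr, rfl⟩, (integralMean_smul c f r).symm⟩
      · rintro ⟨_, ⟨r, hr, rfl⟩, rfl⟩
        exact ⟨r, hr, integralMean_smul c f r⟩
    rw [norm_def, norm_def, h, Real.sSup_smul_of_nonneg (norm_nonneg c), smul_eq_mul]
  norm_triangle f g := norm_le_of_forall _ fun r hr =>
    (integralMean_add_le f.isHardy.holo g.isHardy.holo hr).trans
      (add_le_add (f.integralMean_le_norm hr) (g.integralMean_le_norm hr))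
  norm_eq_zero_iff f := by
    constructor
    · intro h
      refine Subtype.ext (funext fun z => ?_)
      by_cases hz : z ∈ Metric.ball (0 : ℂ) 1
      · exact integralMean_eq_zero f.isHardy.holo (fun r hr => le_antisymm
          (h ▸ f.integralMean_le_norm hr) (integralMean_nonneg _ _)) hz
      · exact f.isHardy.eq_zero z hz
    · rintro rfl
      refine le_antisymm (norm_le_of_forall _ fun r _ => (integralMean_zero r).le) ?_
      exact (integralMean_nonneg _ 0).trans (integralMean_le_norm 0 ⟨le_rfl, one_pos⟩)

instance : NormedAddCommGroup HardySpace := NormedAddCommGroup.ofCore normedSpaceCore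

instance : NormedSpace ℂ HardySpace := NormedSpace.ofCore normedSpaceCore

end HardySpace

/-! ### Universal operators -/

/-- A bounded operator `U` on `E` is universal if for every bounded operator `T` on `E` there are
a constant `α ≠ 0` and a closed subspace `M`, invariant under `U`, such that the restriction of
`U` to `M` is similar to `α T`. -/
def IsUniversalOperator {E : Type*} [NormedAddCommGroup E] [NormedSpace ℂ E]
    (U : E →L[ℂ] E) : Prop :=
  ∀ T : E →L[ℂ] E, ∃ α : ℂ, α ≠ 0 ∧
    ∃ M : Submodule ℂ E, IsClosed (M : Set E) ∧
      ∃ hM : ∀ x ∈ M, U x ∈ M,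
        ∃ S : M ≃L[ℂ] E, ∀ x : M, S ⟨U x, hM x x.2⟩ = α • T (S x)

/-! ### Composition operators with linear fractional symbol -/

/-- The linear fractional map `z ↦ (a z + b) / (c z + d)` at the finite points. Its extension to
the Riemann sphere `OnePoint ℂ` is the action of the invertible matrix `g = (a, b; c, d)`. -/
def linearFractional (g : GL (Fin 2) ℂ) (z : ℂ) : ℂ :=
  (g 0 0 * z + g 0 1) / (g 1 0 * z + g 1 1)

theorem linearFractional_spec (g : GL (Fin 2) ℂ) (z : ℂ) (h : g 1 0 * z + g 1 1 ≠ 0) :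
    g • (z : OnePoint ℂ) = (linearFractional g z : ℂ) := by
  rw [OnePoint.smul_some_eq_ite, if_neg h]
  rfl

/-- The linear fractional map of `g` maps the open unit disc into itself. -/
def IsDiscSelfMap (g : GL (Fin 2) ℂ) : Prop :=
  ∀ z : ℂ, ‖z‖ < 1 → g 1 0 * z + g 1 1 ≠ 0 ∧ ‖linearFractional g z‖ < 1

/-- A linear fractional self-map of the disc is a hyperbolic non-automorphism with boundary fixed
point `ζ` if its fixed points on the Riemann sphere are exactly `ζ`, on the unit circle, and a
second point `η` (possibly `∞`) outside the closed unit disc. -/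
def IsHyperbolicNonAutomorphism (g : GL (Fin 2) ℂ) (ζ : ℂ) : Prop :=
  IsDiscSelfMap g ∧ ‖ζ‖ = 1 ∧
    ∃ η : OnePoint ℂ, η ∉ ((↑) : ℂ → OnePoint ℂ) '' Metric.closedBall 0 1 ∧
      ∀ p : OnePoint ℂ, g • p = p ↔ p = (ζ : OnePoint ℂ) ∨ p = η

/-- The bounded operator `C` on `H²(𝔻)` is the composition operator `f ↦ f ∘ φ`. -/
def IsCompositionOperator (φ : ℂ → ℂ) (C : HardySpace →L[ℂ] HardySpace) : Prop :=
  ∀ (f : HardySpace) (z : ℂ), ‖z‖ < 1 → C f z = f (φ z)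

end

/-!
The composition operator is similar to a weighted dilation of `L²(0, ∞)`, for which Caradus'
criterion can be checked by hand.

*The model.* Let `q` be the reciprocal of the exterior fixed point of `φ` (`q = 0` if that point is
`∞`). The map `w(z) = (1 - q z) / (1 - ζ̄ z)` sends `ζ` to `∞` and the exterior fixed point to `0`,
and `w ∘ φ = w / a` (`exists_normalForm`). The Laplace transform

  `k ↦ (1 - z)⁻¹ ∫₀^∞ k(x) exp (-x (1 / (1 - z) - 1 / 2)) dx`

is a unitary operator from `L²(0, ∞)` onto `H²(𝔻)`: by the generating function of the Laguerre
polynomials it takes the Laguerre functions, an orthonormal basis, to the monomials, and the Hardy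
norm is the `ℓ²` norm of the Taylor coefficients (`LaguerreBasis.hardyLaplace`,
`HardySpace.coeffEquiv`). Composed with the rotation by `ζ̄` and with the multiplication by
`1 - q z`, which is invertible since `|q| < 1`, it becomes an isomorphism under which composition
with `φ` turns into the weighted dilation `k ↦ exp (-κ (1 - a) x) k(a x)`, where `Re κ > 0`
(`HardySpace.modelEquiv_comp`). In particular the composition operator is bounded.

*Universality.* Multiplication by `exp (-κ min(x, c))`, an invertible operator, replaces the weight
by one that equals `1` on `(0, c]` and is as small as desired above the level `c`. Below `c` the
dilation is inverted by an operator of norm `a^{1/2} < 1 / |λ|`, and above `c` its norm is less than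
`|λ|`. So `D - λ` can be inverted by geometric series on both sides of the fundamental domain
`(a c, c]`, and every function on that domain extends to an element of the kernel
(`exists_rightInverse_of_split`, `HalfLine.exists_level_rightInverse`). This gives a right inverse
of `D - λ` and a complemented copy of `ℓ²` in its kernel, from which universality follows by
solving `X = V + α W X T` for an intertwiner `X` (`isUniversalOperator_of_similar`).
-/

/-! ### Taylor coefficients and the Hardy norm -/

namespace HardyDisc

open MeasureTheory in
/-- Parseval's identity for an absolutely convergent power series on the unit circle. -/
theorem hasSum_sq_circleAverage {b : ℕ → ℂ} (hb : Summable fun n => ‖b n‖) :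
    HasSum (fun n => ‖b n‖ ^ 2)
      (Real.circleAverage (fun z => ‖∑' n, b n * z ^ n‖ ^ 2) 0 1) := by
  have : Fact (0 < 2 * Real.pi) := ⟨by positivity⟩
  let G : ℕ → C(AddCircle (2 * Real.pi), ℂ) := fun n => b n • fourier n
  have hG : Summable G := by
    refine Summable.of_norm (hb.congr fun n => ?_)
    simp [G, norm_smul, fourier_norm]
  have hGt : HasSum G (∑' n, G n) := hG.hasSum
  set g := ∑' n, G n with hg
  have hLp : HasSum (fun n => b n • fourierLp (T := 2 * Real.pi) 2 (n : ℤ))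
      (ContinuousMap.toLp 2 AddCircle.haarAddCircle ℂ g) := by
    simpa [G] using (ContinuousMap.toLp (E := ℂ) 2 AddCircle.haarAddCircle ℂ).hasSum hGt
  have hon : Orthonormal ℂ (fun n : ℕ => fourierLp (T := 2 * Real.pi) 2 (n : ℤ)) :=
    orthonormal_fourier.comp _ Nat.cast_injective
  have h1 : HasSum (fun n => ‖b n‖ ^ 2)
      (‖ContinuousMap.toLp 2 (AddCircle.haarAddCircle (T := 2 * Real.pi)) ℂ g‖ ^ 2) :=
    (hLp.norm.pow 2).congr fun s => hon.orthogonalFamily.norm_sum b s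
  have h2 : ‖ContinuousMap.toLp 2 (AddCircle.haarAddCircle (T := 2 * Real.pi)) ℂ g‖ ^ 2
      = ∫ t, ‖g t‖ ^ 2 ∂(AddCircle.haarAddCircle (T := 2 * Real.pi)) := by
    have h := ContinuousMap.inner_toLp (𝕜 := ℂ) (AddCircle.haarAddCircle (T := 2 * Real.pi)) g g
    have h3 : ∀ x, (starRingEnd ℂ) (g x) * g x = ((‖g x‖ ^ 2 : ℝ) : ℂ) := fun x => by
      rw [mul_comm, Complex.mul_conj, Complex.normSq_eq_norm_sq]
    rw [inner_self_eq_norm_sq_to_K] at h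
    simp only [mul_comm _ ((starRingEnd ℂ) _), h3, integral_complex_ofReal] at h
    norm_cast at h
    exact Complex.ofReal_injective h
  rw [h2, AddCircle.integral_haarAddCircle,
    ← AddCircle.intervalIntegral_preimage (2 * Real.pi) 0 (fun t => ‖g t‖ ^ 2)] at h1
  rw [Real.circleAverage_def]
  convert! h1 using 2
  rw [zero_add]
  refine intervalIntegral.integral_congr fun θ _ => ?_
  have : g (θ : AddCircle (2 * Real.pi)) = ∑' n, b n * circleMap 0 1 θ ^ n := by
    rw [hg, ← ContinuousMap.tsum_apply hG]
    refine tsum_congr fun n => ?_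
    simp only [G, ContinuousMap.smul_apply, smul_eq_mul, fourier_coe_apply, circleMap]
    rw [zero_add, Complex.ofReal_one, one_mul, ← Complex.exp_nat_mul]
    congr 2
    have : (Real.pi : ℂ) ≠ 0 := by exact_mod_cast Real.pi_ne_zero
    push_cast
    field_simp
  simp only [this]

theorem hasSum_sq_integralMean {f : ℂ → ℂ} {a : ℕ → ℂ}
    (h : ∀ z : ℂ, ‖z‖ < 1 → HasSum (fun n => a n * z ^ n) (f z)) {r : ℝ}
    (hr : r ∈ Set.Ico (0 : ℝ) 1) :
    HasSum (fun n => ‖a n‖ ^ 2 * (r ^ n) ^ 2) (integralMean f r ^ 2) := by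
  have hrn : ‖(r : ℂ)‖ < 1 := by simpa [abs_of_nonneg hr.1] using hr.2
  have hs : Summable fun n => ‖a n * (r : ℂ) ^ n‖ := (h r hrn).summable.norm
  convert! hasSum_sq_circleAverage hs using 1
  · ext n
    simp [mul_pow, abs_of_nonneg hr.1]
  · rw [integralMean, Real.sq_sqrt (Real.circleAverage_nonneg_of_nonneg fun _ _ => by positivity),
      Real.circleAverage_def, Real.circleAverage_def]
    congr 1
    refine intervalIntegral.integral_congr fun θ _ => ?_
    have hz : ‖circleMap 0 r θ‖ < 1 := by
      rw [norm_circleMap_zero, abs_of_nonneg hr.1]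
      exact hr.2
    rw [← (h _ hz).tsum_eq]
    congr 3
    ext n
    simp only [circleMap, zero_add, Complex.ofReal_one, one_mul]
    ring

theorem hasSum_taylor {f : ℂ → ℂ} (hf : DifferentiableOn ℂ f (Metric.ball 0 1)) {z : ℂ}
    (hz : ‖z‖ < 1) :
    HasSum (fun n : ℕ => ((n.factorial : ℂ)⁻¹ * iteratedDeriv n f 0) * z ^ n) (f z) := by
  have h := Complex.hasSum_taylorSeries_on_ball (c := 0) (r := 1) (f := f) (z := z)
    (by simpa using hf) (by simpa using hz)
  refine h.congr_fun fun n => ?_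
  simp only [sub_zero, smul_eq_mul]
  ring

end HardyDisc

namespace HardySpace

open HardyDisc

/-- Bessel's inequality for the Taylor coefficients: Parseval's identity on the circle of radius
`r`, in the limit `r → 1`. -/
theorem sum_sq_le_norm_sq (f : HardySpace) {a : ℕ → ℂ}
    (h : ∀ z : ℂ, ‖z‖ < 1 → HasSum (fun n => a n * z ^ n) (f z)) (s : Finset ℕ) :
    ∑ n ∈ s, ‖a n‖ ^ 2 ≤ ‖f‖ ^ 2 := by
  have hlim : Filter.Tendsto (fun r : ℝ => ∑ n ∈ s, ‖a n‖ ^ 2 * (r ^ n) ^ 2)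
      (nhdsWithin 1 (Set.Iio 1)) (nhds (∑ n ∈ s, ‖a n‖ ^ 2)) := by
    have hc : Continuous fun r : ℝ => ∑ n ∈ s, ‖a n‖ ^ 2 * (r ^ n) ^ 2 := by fun_prop
    have := (hc.tendsto 1).mono_left (nhdsWithin_le_nhds (s := Set.Iio 1))
    simpa using this
  refine le_of_tendsto hlim ?_
  filter_upwards [Ico_mem_nhdsLT (show (0 : ℝ) < 1 by norm_num)] with r hr
  refine (sum_le_hasSum s (fun _ _ => by positivity) (hasSum_sq_integralMean h hr)).trans ?_
  exact pow_le_pow_left₀ (integralMean_nonneg _ _) (f.integralMean_le_norm hr) 2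

theorem ext_disc {f g : HardySpace} (h : ∀ z : ℂ, ‖z‖ < 1 → f z = g z) : f = g := by
  refine Subtype.ext (funext fun z => ?_)
  by_cases hz : ‖z‖ < 1
  · exact h z hz
  · have hz' : z ∉ Metric.ball (0 : ℂ) 1 := by simpa using hz
    exact (f.isHardy.eq_zero z hz').trans (g.isHardy.eq_zero z hz').symm

theorem hasSum_powerSeries (a : lp (fun _ : ℕ => ℂ) 2) {z : ℂ} (hz : ‖z‖ < 1) :
    HasSum (fun n => a n * z ^ n) (∑' n, a n * z ^ n) := by
  refine Summable.hasSum (Summable.of_norm_bounded (g := fun n => ‖a‖ * ‖z‖ ^ n)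
    ((summable_geometric_of_lt_one (norm_nonneg z) hz).mul_left _) fun n => ?_)
  rw [norm_mul, norm_pow]
  gcongr
  exact lp.norm_apply_le_norm (by norm_num) a n

theorem hasSum_sq_lp (a : lp (fun _ : ℕ => ℂ) 2) : HasSum (fun n => ‖a n‖ ^ 2) (‖a‖ ^ 2) := by
  have := lp.hasSum_norm (p := 2) (by norm_num) a
  simpa using this

theorem integralMean_le_norm_lp {f : ℂ → ℂ} (a : lp (fun _ : ℕ => ℂ) 2)
    (h : ∀ z : ℂ, ‖z‖ < 1 → HasSum (fun n => a n * z ^ n) (f z)) {r : ℝ}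
    (hr : r ∈ Set.Ico (0 : ℝ) 1) : integralMean f r ≤ ‖a‖ := by
  refine abs_le_of_sq_le_sq' ?_ (norm_nonneg a) |>.2
  refine hasSum_le (fun n => ?_) (hasSum_sq_integralMean h hr) (hasSum_sq_lp a)
  have : (r ^ n) ^ 2 ≤ 1 := pow_le_one₀ (pow_nonneg hr.1 n) (pow_le_one₀ hr.1 hr.2.le)
  exact mul_le_of_le_one_right (by positivity) this

open scoped Classical in
theorem isHardy_powerSeries (a : lp (fun _ : ℕ => ℂ) 2) :
    IsHardy (fun z => if ‖z‖ < 1 then ∑' n, a n * z ^ n else 0) := by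
  have hsum : ∀ z : ℂ, ‖z‖ < 1 → HasSum (fun n => a n * z ^ n)
      (if ‖z‖ < 1 then ∑' n, a n * z ^ n else 0) := fun z hz => by
    rw [if_pos hz]
    exact hasSum_powerSeries a hz
  refine ⟨?_, fun z hz => if_neg (by simpa using hz), ⟨‖a‖, ?_⟩⟩
  · have hd : DifferentiableOn ℂ (fun z => ∑' n, a n * z ^ n) (Metric.ball 0 1) := by
      intro z hz
      obtain ⟨r, hzr, hr⟩ := exists_between (mem_ball_zero_iff.1 hz)
      have hr0 : 0 ≤ r := (norm_nonneg z).trans hzr.le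
      have : DifferentiableOn ℂ (fun z => ∑' n, a n * z ^ n) (Metric.ball 0 r) := by
        refine Complex.differentiableOn_tsum_of_summable_norm (u := fun n => ‖a‖ * r ^ n)
          ((summable_geometric_of_lt_one hr0 hr).mul_left _) (fun n => by fun_prop)
          Metric.isOpen_ball fun n w hw => ?_
        rw [norm_mul, norm_pow]
        gcongr
        · exact lp.norm_apply_le_norm (by norm_num) a n
        · exact (mem_ball_zero_iff.1 hw).le
      exact (this.differentiableAt
        (Metric.isOpen_ball.mem_nhds (mem_ball_zero_iff.2 hzr))).differentiableWithinAt
    exact hd.congr fun z hz => if_pos (mem_ball_zero_iff.1 hz)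
  · rintro _ ⟨r, hr, rfl⟩
    exact integralMean_le_norm_lp a hsum hr

open scoped Classical in
/-- The function `∑ aₙ zⁿ` on the disc, for a square summable sequence `a`. -/
noncomputable def ofCoeff (a : lp (fun _ : ℕ => ℂ) 2) : HardySpace :=
  ⟨fun z => if ‖z‖ < 1 then ∑' n, a n * z ^ n else 0, isHardy_powerSeries a⟩

theorem hasSum_ofCoeff (a : lp (fun _ : ℕ => ℂ) 2) {z : ℂ} (hz : ‖z‖ < 1) :
    HasSum (fun n => a n * z ^ n) (ofCoeff a z) := by
  have : ofCoeff a z = ∑' n, a n * z ^ n := if_pos hz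
  rw [this]
  exact hasSum_powerSeries a hz

theorem norm_ofCoeff (a : lp (fun _ : ℕ => ℂ) 2) : ‖ofCoeff a‖ = ‖a‖ := by
  have hsum : ∀ z : ℂ, ‖z‖ < 1 → HasSum (fun n => a n * z ^ n) (ofCoeff a z) :=
    fun z hz => hasSum_ofCoeff a hz
  apply le_antisymm
  · exact norm_le_of_forall _ fun r hr => integralMean_le_norm_lp a hsum hr
  · refine abs_le_of_sq_le_sq' ?_ (norm_nonneg _) |>.2
    exact hasSum_le_of_sum_le (hasSum_sq_lp a) (sum_sq_le_norm_sq _ hsum)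

/-- `H²(𝔻)` is isometric to `ℓ²` through the Taylor coefficients. -/
noncomputable def coeffEquiv : lp (fun _ : ℕ => ℂ) 2 ≃ₗᵢ[ℂ] HardySpace :=
  LinearIsometryEquiv.ofSurjective
    { toFun := ofCoeff
      map_add' := fun a b => ext_disc fun z hz =>
        (hasSum_ofCoeff (a + b) hz).unique <|
          ((hasSum_ofCoeff a hz).add (hasSum_ofCoeff b hz)).congr_fun fun n => by
            simp [add_mul]
      map_smul' := fun c a => ext_disc fun z hz =>
        (hasSum_ofCoeff (c • a) hz).unique <|
          ((hasSum_ofCoeff a hz).mul_left c).congr_fun fun n => by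
            simp [mul_assoc]
      norm_map' := norm_ofCoeff } <| by
    intro f
    have h : ∀ z : ℂ, ‖z‖ < 1 → HasSum
        (fun n : ℕ => ((n.factorial : ℂ)⁻¹ * iteratedDeriv n f 0) * z ^ n) (f z) :=
      fun z hz => hasSum_taylor f.isHardy.holo hz
    have hm : Memℓp (fun n : ℕ => (n.factorial : ℂ)⁻¹ * iteratedDeriv n f 0) 2 := by
      refine memℓp_gen' (C := ‖f‖ ^ 2) fun s => ?_
      simpa using sum_sq_le_norm_sq f h s
    exact ⟨⟨_, hm⟩, ext_disc fun z hz => (hasSum_ofCoeff ⟨_, hm⟩ hz).unique (h z hz)⟩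

theorem hasSum_coeffEquiv (a : lp (fun _ : ℕ => ℂ) 2) {z : ℂ} (hz : ‖z‖ < 1) :
    HasSum (fun n => a n * z ^ n) (coeffEquiv a z) :=
  hasSum_ofCoeff a hz

end HardySpace

/-! ### Laguerre functions -/

namespace LaguerreBasis

open MeasureTheory Polynomial

/-- Lebesgue measure on the half-line `(0, ∞)`. -/
noncomputable abbrev halfLine : Measure ℝ := volume.restrict (Set.Ioi 0)

/-- The Laguerre polynomial `∑ₖ (-1)ᵏ (n choose k) xᵏ / k!`. -/
noncomputable def laguerrePoly (n : ℕ) : ℝ[X] :=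
  ∑ k ∈ Finset.range (n + 1), C ((-1) ^ k * n.choose k / k.factorial : ℝ) * X ^ k

theorem integrable_pow_mul_exp (n : ℕ) :
    Integrable (fun x : ℝ => x ^ n * Real.exp (-x)) halfLine := by
  have h := Real.GammaIntegral_convergent (s := n + 1) (by positivity)
  refine (h.congr_fun (fun x _ => ?_) measurableSet_Ioi : IntegrableOn _ _ _)
  simp [mul_comm]

theorem integral_pow_mul_exp (n : ℕ) :
    ∫ x, x ^ n * Real.exp (-x) ∂halfLine = n.factorial := by
  rw [← Real.Gamma_nat_eq_factorial, Real.Gamma_eq_integral (by positivity)]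
  refine setIntegral_congr_fun measurableSet_Ioi fun x _ => ?_
  simp [mul_comm]

theorem integrable_poly_mul_exp (p : ℝ[X]) :
    Integrable (fun x : ℝ => p.eval x * Real.exp (-x)) halfLine := by
  simp_rw [eval_eq_sum_range, Finset.sum_mul, mul_assoc]
  exact integrable_finsetSum _ fun n _ => (integrable_pow_mul_exp n).const_mul _

/-- The moments of a Laguerre polynomial are iterated differences of the polynomial
`k ↦ (k + 1) ⋯ (k + j)`. -/
theorem integral_pow_mul_laguerrePoly (j n : ℕ) :
    ∫ x, (X ^ j * laguerrePoly n).eval x * Real.exp (-x) ∂halfLine =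
      (-1) ^ n * (fwdDiff 1)^[n] ((ascPochhammer ℝ j).comp (X + 1)).eval 0 := by
  have h1 : ∀ x : ℝ, (X ^ j * laguerrePoly n).eval x * Real.exp (-x) =
      ∑ k ∈ Finset.range (n + 1), ((-1) ^ k * n.choose k / k.factorial : ℝ) *
        (x ^ (k + j) * Real.exp (-x)) := fun x => by
    simp only [laguerrePoly, eval_mul, eval_pow, eval_X, eval_finsetSum, eval_C, Finset.mul_sum,
      Finset.sum_mul]
    exact Finset.sum_congr rfl fun k _ => by ring
  simp_rw [h1]
  rw [integral_finsetSum _ fun k _ => (integrable_pow_mul_exp _).const_mul _,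
    fwdDiff_iter_eq_sum_shift, Finset.mul_sum]
  refine Finset.sum_congr rfl fun k hk => ?_
  rw [integral_const_mul, integral_pow_mul_exp]
  have hkn : k ≤ n := Nat.lt_succ_iff.1 (Finset.mem_range.1 hk)
  have h2 : ((k + j).factorial : ℝ) = k.factorial * (ascPochhammer ℝ j).eval ((k : ℝ) + 1) := by
    rw [← Nat.factorial_mul_ascFactorial, Nat.cast_mul, ← ascPochhammer_nat_eq_ascFactorial,
      ← Nat.cast_succ, ascPochhammer_eval_cast]
  have h3 : ((-1 : ℝ)) ^ n = (-1) ^ (n - k) * (-1) ^ k := by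
    rw [← pow_add, Nat.sub_add_cancel hkn]
  have h4 : ((-1 : ℝ) ^ (n - k)) * (-1) ^ (n - k) = 1 := by
    rw [← mul_pow]
    simp
  have h5 : (k.factorial : ℝ) ≠ 0 := by positivity
  simp only [zero_add, nsmul_eq_mul, mul_one, eval_comp, eval_add, eval_X, eval_one, zsmul_eq_mul,
    Int.cast_mul, Int.cast_pow, Int.cast_neg, Int.cast_one, Int.cast_natCast]
  rw [h2, h3]
  field_simp
  linear_combination -h4 * (n.choose k) * (ascPochhammer ℝ j).eval ((k : ℝ) + 1)

theorem natDegree_ascPochhammer_comp (j : ℕ) :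
    ((ascPochhammer ℝ j).comp (X + 1)).natDegree = j := by
  rw [natDegree_comp, ascPochhammer_natDegree]
  have := natDegree_X_add_C (1 : ℝ)
  rw [C_1] at this
  rw [this, mul_one]

theorem integral_pow_mul_laguerrePoly_of_lt {j n : ℕ} (h : j < n) :
    ∫ x, (X ^ j * laguerrePoly n).eval x * Real.exp (-x) ∂halfLine = 0 := by
  rw [integral_pow_mul_laguerrePoly, fwdDiff_iter_eq_zero_of_degree_lt
    (by rwa [natDegree_ascPochhammer_comp])]
  simp

theorem integral_pow_mul_laguerrePoly_self (n : ℕ) :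
    ∫ x, (X ^ n * laguerrePoly n).eval x * Real.exp (-x) ∂halfLine = (-1) ^ n * n.factorial := by
  have h := fwdDiff_iter_degree_eq_factorial ((ascPochhammer ℝ n).comp (X + 1))
  rw [natDegree_ascPochhammer_comp] at h
  have hm : ((ascPochhammer ℝ n).comp (X + 1)).Monic := by
    have : (X + 1 : ℝ[X]) = X + C 1 := by simp
    rw [this]
    exact (monic_ascPochhammer ℝ n).comp_X_add_C 1
  rw [integral_pow_mul_laguerrePoly, h, hm.leadingCoeff]
  simp

theorem integral_laguerrePoly_mul {m n : ℕ} (h : m ≤ n) :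
    ∫ x, (laguerrePoly m * laguerrePoly n).eval x * Real.exp (-x) ∂halfLine =
      if m = n then 1 else 0 := by
  have h1 : ∀ x : ℝ, (laguerrePoly m * laguerrePoly n).eval x * Real.exp (-x) =
      ∑ k ∈ Finset.range (m + 1), ((-1) ^ k * m.choose k / k.factorial : ℝ) *
        ((X ^ k * laguerrePoly n).eval x * Real.exp (-x)) := fun x => by
    conv_lhs => rw [laguerrePoly]
    simp only [eval_mul, eval_pow, eval_X, eval_finsetSum, eval_C, Finset.sum_mul]
    exact Finset.sum_congr rfl fun k _ => by ring
  simp_rw [h1]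
  rw [integral_finsetSum _ fun k _ => (integrable_poly_mul_exp _).const_mul _]
  simp_rw [integral_const_mul]
  rw [Finset.sum_range_succ, Finset.sum_eq_zero, zero_add]
  · split_ifs with hmn
    · subst hmn
      rw [integral_pow_mul_laguerrePoly_self]
      have h5 : (m.factorial : ℝ) ≠ 0 := by positivity
      field_simp
      simp [← pow_mul]
    · rw [integral_pow_mul_laguerrePoly_of_lt (by omega), mul_zero]
  · intro k hk
    rw [integral_pow_mul_laguerrePoly_of_lt (by have := Finset.mem_range.1 hk; omega), mul_zero]

/-- The Laguerre function `Lₙ(x) e^{-x/2}`. -/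
noncomputable def laguerreFun (n : ℕ) (x : ℝ) : ℝ := (laguerrePoly n).eval x * Real.exp (-x / 2)

theorem continuous_laguerreFun (n : ℕ) : Continuous (laguerreFun n) := by
  unfold laguerreFun
  fun_prop

theorem laguerreFun_mul (m n : ℕ) (x : ℝ) : laguerreFun m x * laguerreFun n x =
    (laguerrePoly m * laguerrePoly n).eval x * Real.exp (-x) := by
  have : Real.exp (-x) = Real.exp (-x / 2) * Real.exp (-x / 2) := by
    rw [← Real.exp_add]; ring_nf
  rw [this, laguerreFun, laguerreFun, eval_mul]
  ring

theorem memLp_laguerreFun (n : ℕ) : MemLp (fun x => (laguerreFun n x : ℂ)) 2 halfLine := by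
  rw [memLp_two_iff_integrable_sq_norm (by
    exact (Complex.continuous_ofReal.comp (continuous_laguerreFun n)).aestronglyMeasurable)]
  refine (integrable_poly_mul_exp (laguerrePoly n * laguerrePoly n)).congr (ae_of_all _ fun x => ?_)
  simp only [← laguerreFun_mul, Complex.norm_real, Real.norm_eq_abs, sq_abs]
  ring

/-- The Laguerre functions as elements of `L²(0, ∞)`. -/
noncomputable def laguerreLp (n : ℕ) : Lp ℂ 2 halfLine := (memLp_laguerreFun n).toLp

theorem inner_laguerreLp (n : ℕ) (k : Lp ℂ 2 halfLine) :
    inner ℂ (laguerreLp n) k = ∫ x, (laguerreFun n x : ℂ) * k x ∂halfLine := by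
  rw [L2.inner_def]
  refine integral_congr_ae ?_
  filter_upwards [(memLp_laguerreFun n).coeFn_toLp] with x hx
  rw [laguerreLp, hx]
  simp [mul_comm]

theorem orthonormal_laguerreLp : Orthonormal ℂ laguerreLp := by
  have key : ∀ m n : ℕ, m ≤ n →
      inner ℂ (laguerreLp m) (laguerreLp n) = if m = n then (1 : ℂ) else 0 := by
    intro m n hmn
    rw [inner_laguerreLp]
    have : ∫ x, (laguerreFun m x : ℂ) * laguerreLp n x ∂halfLine =
        ∫ x, ((laguerreFun m x * laguerreFun n x : ℝ) : ℂ) ∂halfLine := by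
      refine integral_congr_ae ?_
      filter_upwards [(memLp_laguerreFun n).coeFn_toLp] with x hx
      rw [laguerreLp, hx]
      simp
    rw [this, integral_complex_ofReal]
    simp_rw [laguerreFun_mul]
    rw [integral_laguerrePoly_mul hmn]
    split_ifs <;> simp
  rw [orthonormal_iff_ite]
  intro m n
  rcases le_total m n with h | h
  · exact key m n h
  · rw [← inner_conj_symm, key n m h]
    by_cases hmn : m = n
    · simp [hmn]
    · simp [hmn, Ne.symm hmn]

theorem integral_norm_sq {α : Type*} [MeasurableSpace α] {μ : Measure α} (f : Lp ℂ 2 μ) :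
    ∫ x, ‖f x‖ ^ 2 ∂μ = ‖f‖ ^ 2 := by
  have h := L2.inner_def (𝕜 := ℂ) f f
  have h3 : ∀ x, inner ℂ (f x) (f x) = ((‖f x‖ ^ 2 : ℝ) : ℂ) := fun x => by
    rw [inner_self_eq_norm_sq_to_K]
    norm_cast
  rw [inner_self_eq_norm_sq_to_K] at h
  simp only [h3, integral_complex_ofReal] at h
  norm_cast at h
  exact (Complex.ofReal_injective h).symm

theorem hasSum_range_sub {G : ℕ × ℕ → ℂ} {S : ℂ} (hG : HasSum G S) :
    HasSum (fun n => ∑ k ∈ Finset.range (n + 1), G (k, n - k)) S := by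
  refine (((Finset.HasAntidiagonal.sigmaAntidiagonalEquivProd (A := ℕ)).hasSum_iff.2 hG).sigma
    fun n => hasSum_fintype _).congr_fun fun n => ?_
  rw [← Finset.Nat.sum_antidiagonal_eq_sum_range_succ (fun i j => G (i, j))]
  exact (Finset.sum_coe_sort (Finset.HasAntidiagonal.antidiagonal n) G).symm

/-- The generating function of the Laguerre functions. -/
theorem hasSum_laguerreFun {z : ℂ} (hz : ‖z‖ < 1) {x : ℝ} (hx : 0 ≤ x) :
    HasSum (fun n => z ^ n * (laguerreFun n x : ℂ))
      ((1 - z)⁻¹ * Complex.exp (-x * ((1 - z)⁻¹ - 1 / 2))) := by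
  have hz1 : 1 - z ≠ 0 := by
    intro h
    rw [← sub_eq_zero.1 h] at hz
    simp at hz
  have hz1' : 0 < 1 - ‖z‖ := by linarith
  let G : ℕ × ℕ → ℂ := fun p =>
    ((p.2 + p.1).choose p.1 * z ^ p.2) * ((-x * z) ^ p.1 / p.1.factorial)
  have hrow : ∀ k : ℕ, HasSum (fun j => G (k, j))
      (1 / (1 - z) ^ (k + 1) * ((-x * z) ^ k / k.factorial)) := fun k =>
    ((hasSum_choose_mul_geometric_of_norm_lt_one k hz).mul_right
      ((-x * z) ^ k / k.factorial)).congr_fun fun j => by simp only [G]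
  have hrow' : ∀ k : ℕ, HasSum (fun j => ‖G (k, j)‖)
      (1 / (1 - ‖z‖) ^ (k + 1) * ((x * ‖z‖) ^ k / k.factorial)) := fun k => by
    refine ((hasSum_choose_mul_geometric_of_norm_lt_one (𝕜 := ℝ) k (r := ‖z‖)
      (by simpa using hz)).mul_right ((x * ‖z‖) ^ k / k.factorial)).congr_fun fun j => ?_
    simp [G, abs_of_nonneg hx]
  have hS : Summable G := by
    rw [← summable_norm_iff, summable_prod_of_nonneg (fun _ => norm_nonneg _)]
    refine ⟨fun k => (hrow' k).summable, ?_⟩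
    simp_rw [fun k => (hrow' k).tsum_eq]
    refine ((Real.summable_pow_div_factorial (x * ‖z‖ / (1 - ‖z‖))).mul_left
      (1 / (1 - ‖z‖))).congr fun k => ?_
    rw [div_pow]
    field_simp
    ring
  have htot : HasSum (fun k : ℕ => 1 / (1 - z) ^ (k + 1) * ((-x * z) ^ k / k.factorial))
      ((1 - z)⁻¹ * Complex.exp (-x * z / (1 - z))) := by
    have := (NormedSpace.expSeries_div_hasSum_exp (-x * z / (1 - z))).mul_left (1 - z)⁻¹
    rw [← Complex.exp_eq_exp_ℂ] at this
    refine this.congr_fun fun k => ?_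
    rw [div_pow]
    field_simp
    ring
  have hG : HasSum G ((1 - z)⁻¹ * Complex.exp (-x * z / (1 - z))) := by
    have := hS.hasSum.prod_fiberwise hrow
    rw [htot.unique this]
    exact hS.hasSum
  have hdiag := hasSum_range_sub hG
  have hexp : (1 - z)⁻¹ * Complex.exp (-x * ((1 - z)⁻¹ - 1 / 2)) =
      (1 - z)⁻¹ * Complex.exp (-x * z / (1 - z)) * Complex.exp (-x / 2) := by
    rw [mul_assoc, ← Complex.exp_add]
    congr 2
    field_simp
    ring
  rw [hexp]
  refine (hdiag.mul_right (Complex.exp (-x / 2))).congr_fun fun n => ?_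
  rw [laguerreFun, laguerrePoly]
  push_cast
  rw [← mul_assoc]
  congr 1
  rw [eval_finsetSum, Complex.ofReal_sum, Finset.mul_sum]
  refine Finset.sum_congr rfl fun k hk => ?_
  have hkn : k ≤ n := Nat.lt_succ_iff.1 (Finset.mem_range.1 hk)
  simp only [G, Nat.sub_add_cancel hkn, eval_mul, eval_C, eval_pow, eval_X]
  have : z ^ n = z ^ (n - k) * z ^ k := by rw [← pow_add, Nat.sub_add_cancel hkn]
  rw [this]
  push_cast
  rw [mul_pow, neg_pow]
  ring

theorem norm_laguerreLp (n : ℕ) : ‖laguerreLp n‖ = 1 := orthonormal_laguerreLp.1 n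

/-- The Laguerre coefficients of `k`, as the Taylor coefficients of the weighted Laplace
transform of `k`. -/
theorem hasSum_inner_laguerreLp (k : Lp ℂ 2 halfLine) {z : ℂ} (hz : ‖z‖ < 1) :
    HasSum (fun n => inner ℂ (laguerreLp n) k * z ^ n)
      ((1 - z)⁻¹ * ∫ x, k x * Complex.exp (-x * ((1 - z)⁻¹ - 1 / 2)) ∂halfLine) := by
  have hk : MemLp k 2 halfLine := Lp.memLp k
  have hint : ∀ n, Integrable (fun x => (laguerreFun n x : ℂ) * k x) halfLine := fun n =>
    (memLp_laguerreFun n).integrable_mul hk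
  have hF : ∀ n, Integrable (fun x => z ^ n * (laguerreFun n x : ℂ) * k x) halfLine := fun n => by
    simp_rw [mul_assoc]
    exact (hint n).const_mul _
  -- the arithmetic-geometric mean inequality bounds these integrals uniformly in `n`
  have hCS : ∀ n, ∫ x, ‖(laguerreFun n x : ℂ) * k x‖ ∂halfLine ≤ (1 + ‖k‖ ^ 2) / 2 := fun n => by
    have h0 : ∀ x, ‖(laguerreFun n x : ℂ) * k x‖ ≤
        (‖(laguerreFun n x : ℂ)‖ ^ 2 + ‖k x‖ ^ 2) / 2 := fun x => by
      rw [norm_mul]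
      linarith [two_mul_le_add_sq ‖(laguerreFun n x : ℂ)‖ ‖k x‖]
    have hi1 := (memLp_laguerreFun n).integrable_norm_pow (p := 2) (by norm_num)
    have hi2 := hk.integrable_norm_pow (p := 2) (by norm_num)
    have h1 : ∫ x, ‖(laguerreFun n x : ℂ)‖ ^ 2 ∂halfLine = 1 := by
      rw [← one_pow 2, ← norm_laguerreLp n, ← integral_norm_sq]
      refine integral_congr_ae ?_
      filter_upwards [(memLp_laguerreFun n).coeFn_toLp] with x hx
      rw [laguerreLp, hx]
    refine (integral_mono (hint n).norm ((hi1.add hi2).div_const 2) h0).trans_eq ?_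
    simp only [Pi.add_apply]
    rw [integral_div, integral_add hi1 hi2, h1, integral_norm_sq]
  have hsum : Summable fun n => ∫ x, ‖z ^ n * (laguerreFun n x : ℂ) * k x‖ ∂halfLine := by
    refine Summable.of_nonneg_of_le (fun n => integral_nonneg fun _ => norm_nonneg _) (fun n => ?_)
      ((summable_geometric_of_lt_one (norm_nonneg z) hz).mul_right ((1 + ‖k‖ ^ 2) / 2))
    simp_rw [mul_assoc, norm_mul (z ^ n), integral_const_mul, norm_pow]
    gcongr
    exact hCS n
  have h := hasSum_integral_of_summable_integral_norm hF hsum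
  have hval : ∫ x, ∑' n, z ^ n * (laguerreFun n x : ℂ) * k x ∂halfLine =
      (1 - z)⁻¹ * ∫ x, k x * Complex.exp (-x * ((1 - z)⁻¹ - 1 / 2)) ∂halfLine := by
    rw [← integral_const_mul]
    refine setIntegral_congr_fun measurableSet_Ioi fun x hx => ?_
    rw [((hasSum_laguerreFun hz (le_of_lt hx)).mul_right (k x)).tsum_eq]
    ring
  rw [hval] at h
  refine h.congr_fun fun n => ?_
  rw [inner_laguerreLp]
  simp_rw [mul_assoc, integral_const_mul]
  ring

end LaguerreBasis

namespace LaguerreBasis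

open MeasureTheory Polynomial

/-- An integrable function on the half-line all of whose exponential moments vanish is zero: by
Weierstrass, the polynomials in `e^{-x}` approximate the test functions uniformly. -/
theorem ae_eq_zero_of_integral_exp_eq_zero {h : ℝ → ℂ} (hh : Integrable h halfLine)
    (h0 : ∀ n : ℕ, ∫ x, (Real.exp (-x) ^ n : ℝ) • h x ∂halfLine = 0) : h =ᵐ[halfLine] 0 := by
  have hpoly : ∀ p : ℝ[X], Integrable (fun x => p.eval (Real.exp (-x)) • h x) halfLine ∧
      ∫ x, p.eval (Real.exp (-x)) • h x ∂halfLine = 0 := by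
    have hm : ∀ n : ℕ, Integrable (fun x => (Real.exp (-x) ^ n : ℝ) • h x) halfLine := fun n => by
      have hc : Continuous fun x : ℝ => Real.exp (-x) ^ n := by fun_prop
      refine hh.bdd_smul 1 hc.aestronglyMeasurable ?_
      filter_upwards [ae_restrict_mem measurableSet_Ioi] with x hx
      have hx' : (0 : ℝ) < x := hx
      rw [Real.norm_of_nonneg (pow_nonneg (Real.exp_nonneg _) n)]
      exact pow_le_one₀ (Real.exp_nonneg _) (Real.exp_le_one_iff.2 (by linarith))
    intro p
    have he : ∀ x, p.eval (Real.exp (-x)) • h x =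
        ∑ n ∈ Finset.range (p.natDegree + 1), p.coeff n • ((Real.exp (-x) ^ n : ℝ) • h x) :=
      fun x => by
        rw [eval_eq_sum_range, Finset.sum_smul]
        simp_rw [mul_smul]
    simp_rw [he]
    have hm' : ∀ n ∈ Finset.range (p.natDegree + 1), Integrable
        (fun x => p.coeff n • ((Real.exp (-x) ^ n : ℝ) • h x)) halfLine :=
      fun n _ => (hm n).smul (p.coeff n)
    refine ⟨integrable_finsetSum _ hm', ?_⟩
    rw [integral_finsetSum _ hm']
    simp_rw [integral_smul, h0]
    simp
  have hmain := isOpen_Ioi.ae_eq_zero_of_integral_contDiff_smul_eq_zero (μ := volume) (f := h)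
    (U := Set.Ioi 0) (IntegrableOn.locallyIntegrableOn hh) ?_
  · rw [Filter.EventuallyEq, ae_restrict_iff' measurableSet_Ioi]
    exact hmain
  intro g hg hgc hgs
  -- the test function, in the variable `y = e^{-x}`
  let G : ℝ → ℝ := fun y => g (-Real.log y)
  have hG : Continuous G := by
    obtain ⟨M, hM⟩ := hgc.isCompact.bddAbove
    have hout : ∀ x, M < x ∨ x ≤ 0 → g x = 0 := by
      refine fun x hx => image_eq_zero_of_notMem_tsupport fun hmem => ?_
      rcases hx with hx | hx
      · exact absurd (hM hmem) (not_le.2 hx)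
      · exact absurd (hgs hmem) (not_lt.2 hx)
    refine continuous_iff_continuousAt.2 fun y => ?_
    rcases eq_or_ne y 0 with rfl | hy
    · have hev : ∀ᶠ y in nhdsWithin (0 : ℝ) {0}ᶜ, G y = 0 := by
        filter_upwards [Real.tendsto_log_nhdsNE_zero.eventually (Filter.eventually_lt_atBot (-M))]
          with y hy
        exact hout _ (Or.inl (by linarith))
      have hG0 : G 0 = 0 := hout _ (Or.inr (by simp))
      rw [eventually_nhdsWithin_iff] at hev
      refine (continuousAt_const (y := (0 : ℝ))).congr ?_
      filter_upwards [hev] with y hy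
      by_cases h : y = 0
      · rw [h, hG0]
      · exact (hy h).symm
    · exact hg.continuous.continuousAt.comp (Real.continuousAt_log hy).neg
  have hGe : ∀ x, G (Real.exp (-x)) = g x := fun x => by simp [G]
  have hset : ∫ x, g x • h x = ∫ x, g x • h x ∂halfLine := by
    refine (setIntegral_eq_integral_of_forall_compl_eq_zero fun x hx => ?_).symm
    rw [image_eq_zero_of_notMem_tsupport fun h => hx (hgs h), zero_smul]
  rw [hset, ← norm_le_zero_iff]
  refine le_of_forall_pos_le_add fun ε hε => ?_
  set B := ∫ x, ‖h x‖ ∂halfLine with hB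
  have hB0 : 0 ≤ B := integral_nonneg fun _ => norm_nonneg _
  obtain ⟨p, hp⟩ := exists_polynomial_near_of_continuousOn 0 1 G hG.continuousOn
    (ε / (B + 1)) (by positivity)
  have hgi : Integrable (fun x => g x • h x) halfLine := by
    obtain ⟨A, hA⟩ := hgc.exists_bound_of_continuous hg.continuous
    exact hh.bdd_smul A hg.continuous.aestronglyMeasurable (ae_of_all _ hA)
  have hdiff : ∫ x, g x • h x ∂halfLine =
      ∫ x, (g x • h x - p.eval (Real.exp (-x)) • h x) ∂halfLine := by
    rw [integral_sub hgi (hpoly p).1, (hpoly p).2, sub_zero]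
  rw [hdiff]
  calc ‖∫ x, (g x • h x - p.eval (Real.exp (-x)) • h x) ∂halfLine‖
      ≤ ∫ x, ε / (B + 1) * ‖h x‖ ∂halfLine := by
        refine norm_integral_le_of_norm_le (hh.norm.const_mul _) ?_
        filter_upwards [ae_restrict_mem measurableSet_Ioi] with x hx
        have hx' : (0 : ℝ) < x := hx
        rw [← sub_smul, norm_smul]
        gcongr
        rw [Real.norm_eq_abs, abs_sub_comm, ← hGe]
        exact (hp _ ⟨Real.exp_nonneg _, Real.exp_le_one_iff.2 (by linarith)⟩).le
    _ = ε * (B / (B + 1)) := by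
        rw [integral_const_mul]
        ring
    _ ≤ 0 + ε := by
        rw [zero_add]
        exact mul_le_of_le_one_right hε.le (div_le_one_of_le₀ (by linarith) (by positivity))

/-- Completeness: a function orthogonal to all Laguerre functions has, by the generating function,
vanishing Laplace transform at the points `n + 1 / 2`. -/
theorem span_laguerreLp_orthogonal :
    (Submodule.span ℂ (Set.range laguerreLp))ᗮ = ⊥ := by
  rw [Submodule.eq_bot_iff]
  intro k hk
  have hcoef : ∀ n, inner ℂ (laguerreLp n) k = 0 := fun n =>
    (Submodule.mem_orthogonal _ _).1 hk _ (Submodule.subset_span ⟨n, rfl⟩)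
  have hexp2 : MemLp (fun x : ℝ => (Real.exp (-x / 2) : ℂ)) 2 halfLine := by
    have := memLp_laguerreFun 0
    simpa [laguerreFun, laguerrePoly] using this
  have hint : Integrable (fun x => (Real.exp (-x / 2) : ℂ) * k x) halfLine :=
    hexp2.integrable_mul (Lp.memLp k)
  have hz : (fun x => (Real.exp (-x / 2) : ℂ) * k x) =ᵐ[halfLine] 0 := by
    refine ae_eq_zero_of_integral_exp_eq_zero hint fun n => ?_
    -- the point of the disc with `1 / (1 - z) = n + 1`
    have hn : (0 : ℝ) < n + 1 := by positivity
    have hn' : ((n : ℂ) + 1) ≠ 0 := by exact_mod_cast hn.ne'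
    set z : ℂ := ((n / (n + 1) : ℝ) : ℂ) with hzdef
    have hz1 : ‖z‖ < 1 := by
      rw [Complex.norm_real, Real.norm_of_nonneg (by positivity), div_lt_one hn]
      linarith
    have hz2 : 1 - z = ((n : ℂ) + 1)⁻¹ := by
      rw [hzdef]
      push_cast
      field_simp
      ring
    have h1 := hasSum_inner_laguerreLp k hz1
    simp only [hcoef, zero_mul] at h1
    have h2 := h1.unique hasSum_zero
    rw [hz2, inv_inv] at h2
    rw [← (mul_eq_zero.1 h2).resolve_left hn']
    refine integral_congr_ae (ae_of_all _ fun x => ?_)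
    simp only [Complex.real_smul, ← mul_assoc]
    rw [mul_comm (k x), ← Complex.ofReal_mul, ← Real.exp_nat_mul, ← Real.exp_add,
      Complex.ofReal_exp]
    congr 2
    push_cast
    ring
  rw [Lp.eq_zero_iff_ae_eq_zero]
  filter_upwards [hz] with x hx
  exact (mul_eq_zero.1 hx).resolve_left (by exact_mod_cast (Real.exp_pos _).ne')

/-- The Laguerre functions as a Hilbert basis of `L²(0, ∞)`. -/
noncomputable def laguerreBasis : HilbertBasis ℕ ℂ (Lp ℂ 2 halfLine) :=
  HilbertBasis.mkOfOrthogonalEqBot orthonormal_laguerreLp span_laguerreLp_orthogonal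

/-- The unitary operator from `L²(0, ∞)` onto `H²(𝔻)` taking the Laguerre functions to the
monomials. -/
noncomputable def hardyLaplace : Lp ℂ 2 halfLine ≃ₗᵢ[ℂ] HardySpace :=
  laguerreBasis.repr.trans HardySpace.coeffEquiv

theorem hardyLaplace_apply (k : Lp ℂ 2 halfLine) {z : ℂ} (hz : ‖z‖ < 1) :
    hardyLaplace k z =
      (1 - z)⁻¹ * ∫ x, k x * Complex.exp (-x * ((1 - z)⁻¹ - 1 / 2)) ∂halfLine := by
  refine (HardySpace.hasSum_coeffEquiv _ hz).unique
    ((hasSum_inner_laguerreLp k hz).congr_fun fun n => ?_)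
  congr 1
  refine (laguerreBasis.repr_apply_apply k n).trans ?_
  rw [laguerreBasis, HilbertBasis.coe_mkOfOrthogonalEqBot]

end LaguerreBasis

/-! ### Caradus' criterion for universality -/

section Universality

/-- If `A` has a right inverse `W` and a copy `V` of `E` in its kernel, complemented by a left
inverse `J` of `V` that annihilates the range of `W`, then every `T` on `E` has a multiple
`α T` that `A` lifts: the intertwiner solves `X = V + α W X T`. -/
theorem exists_intertwiner {E F : Type*} [NormedAddCommGroup E] [NormedSpace ℂ E]
    [NormedAddCommGroup F] [NormedSpace ℂ F] [CompleteSpace F]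
    {A W : F →L[ℂ] F} {V : E →L[ℂ] F} {J : F →L[ℂ] E}
    (hAV : A ∘L V = 0) (hAW : A ∘L W = .id ℂ F) (hJV : J ∘L V = .id ℂ E) (hJW : J ∘L W = 0)
    (T : E →L[ℂ] E) :
    ∃ α : ℂ, α ≠ 0 ∧ ∃ X : E →L[ℂ] F, J ∘L X = .id ℂ E ∧ A ∘L X = α • (X ∘L T) := by
  let Φ : (E →L[ℂ] F) →L[ℂ] (E →L[ℂ] F) :=
    (ContinuousLinearMap.compL ℂ E F F W) ∘L ((ContinuousLinearMap.compL ℂ E E F).flip T)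
  obtain ⟨α, hα, hlt⟩ : ∃ α : ℂ, α ≠ 0 ∧ ‖α • Φ‖ < 1 := by
    have hpos : 0 < ‖Φ‖ + 1 := by positivity
    refine ⟨((‖Φ‖ + 1)⁻¹ : ℝ), by exact_mod_cast (inv_pos.2 hpos).ne', ?_⟩
    refine (ContinuousLinearMap.opNorm_smul_le _ Φ).trans_lt ?_
    rw [Complex.norm_real, Real.norm_of_nonneg (inv_nonneg.2 hpos.le),
      inv_mul_lt_iff₀ hpos]
    linarith
  let u := Units.oneSub (α • Φ) hlt
  let X : E →L[ℂ] F := (↑u⁻¹ : (E →L[ℂ] F) →L[ℂ] (E →L[ℂ] F)) V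
  have hX : X - α • (W ∘L X ∘L T) = V := by
    have h : (u : (E →L[ℂ] F) →L[ℂ] (E →L[ℂ] F)) X = V :=
      congrArg (fun f : (E →L[ℂ] F) →L[ℂ] (E →L[ℂ] F) => f V) u.mul_inv
    exact h
  have hX' : X = V + α • (W ∘L X ∘L T) := by rw [← hX]; abel
  refine ⟨α, hα, X, ?_, ?_⟩
  · rw [hX', ContinuousLinearMap.comp_add, ContinuousLinearMap.comp_smul,
      ← ContinuousLinearMap.comp_assoc, hJW, hJV]
    simp
  · conv_lhs => rw [hX', ContinuousLinearMap.comp_add, ContinuousLinearMap.comp_smul,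
      ← ContinuousLinearMap.comp_assoc, hAW, hAV]
    simp

/-- Caradus' criterion, for an operator `U` on `E` that is similar to `A`. -/
theorem isUniversalOperator_of_similar {E F : Type*} [NormedAddCommGroup E] [NormedSpace ℂ E]
    [NormedAddCommGroup F] [NormedSpace ℂ F] [CompleteSpace F] {U : E →L[ℂ] E}
    {A W : F →L[ℂ] F} {V : E →L[ℂ] F} {J : F →L[ℂ] E} (G : F ≃L[ℂ] E)
    (hUG : ∀ x, U (G x) = G (A x))
    (hAV : A ∘L V = 0) (hAW : A ∘L W = .id ℂ F) (hJV : J ∘L V = .id ℂ E) (hJW : J ∘L W = 0) :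
    IsUniversalOperator U := by
  intro T
  obtain ⟨α, hα, X, hJX, hAX⟩ := exists_intertwiner hAV hAW hJV hJW T
  have hAX' : ∀ e, A (X e) = α • X (T e) := fun e => DFunLike.congr_fun hAX e
  let Y : E →L[ℂ] E := (G : F →L[ℂ] E) ∘L X
  let J' : E →L[ℂ] E := J ∘L (G.symm : E →L[ℂ] F)
  have hJY : ∀ e, J' (Y e) = e := fun e => by
    have h : J (X e) = e := DFunLike.congr_fun hJX e
    simpa [J', Y] using h
  have hUY : ∀ e, U (Y e) = α • Y (T e) := fun e => by
    simp [Y, hUG, hAX']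
  have hmem : ∀ y, y ∈ Y.range ↔ Y (J' y) = y := fun y => by
    constructor
    · rintro ⟨e, rfl⟩
      exact congrArg Y (hJY e)
    · exact fun h => ⟨J' y, h⟩
  refine ⟨α, hα, Y.range, ?_, ?_, ?_⟩
  · have : (Y.range : Set E) = {y | Y (J' y) = y} := Set.ext hmem
    rw [this]
    exact isClosed_eq (Y.continuous.comp J'.continuous) continuous_id
  · rintro _ ⟨e, rfl⟩
    exact ⟨α • T e, by rw [map_smul]; exact (hUY e).symm⟩
  · refine ⟨ContinuousLinearEquiv.equivOfInverse (J' ∘L Y.range.subtypeL)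
      (Y.codRestrict Y.range fun e => ⟨e, rfl⟩) (fun y => Subtype.ext ((hmem y).1 y.2)) hJY, ?_⟩
    rintro ⟨_, e, rfl⟩
    have h1 : J' (U (Y e)) = α • T (J' (Y e)) := by rw [hUY, map_smul, hJY, hJY]
    exact h1

/-- In a complete normed algebra, let `P`, `Q = 1 - P` and `R` play the parts of the projections
onto the functions living below a level, above it, and on a fundamental domain at that level. If
`D` moves functions up, `B` inverts `D` below the level, and the geometric series of `λ B` and of
`λ⁻¹ D Q` converge, then `D - λ` has a right inverse `W` vanishing on the fundamental domain, and
every datum on the fundamental domain extends, by `K`, to an element of the kernel. -/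
theorem exists_rightInverse_of_split {𝒜 : Type*} [NormedRing 𝒜] [NormedAlgebra ℂ 𝒜]
    [CompleteSpace 𝒜] {D B P R : 𝒜} {l : ℂ} (hl : l ≠ 0)
    (hDB : D * B = P) (hPB : P * B = B) (hRB : R * B = 0) (hRP : R * P = R) (hPR : P * R = R)
    (hPP : P * P = P) (hRR : R * R = R) (hPDQ : P * D * (1 - P) = 0) (hPDR : P * D * R = 0)
    (hB : ‖l • B‖ < 1) (hDQ : ‖l⁻¹ • (D * (1 - P))‖ < 1) :
    ∃ W K : 𝒜, (D - l • 1) * W = 1 ∧ (D - l • 1) * (K * R) = 0 ∧ R * W = 0 ∧ R * (K * R) = R := by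
  set Q := 1 - P with hQ
  let N : 𝒜 := ↑(Units.oneSub (l • B) hB)⁻¹
  let M : 𝒜 := ↑(Units.oneSub (l⁻¹ • (D * Q)) hDQ)⁻¹
  have hN : N = 1 + l • (B * N) := by
    have h : (1 - l • B) * N = 1 := (Units.oneSub (l • B) hB).mul_inv
    rw [← h, sub_mul, one_mul, smul_mul_assoc]
    abel
  have hM : M = 1 + l⁻¹ • (D * Q * M) := by
    have h : (1 - l⁻¹ • (D * Q)) * M = 1 := (Units.oneSub (l⁻¹ • (D * Q)) hDQ).mul_inv
    rw [← h, sub_mul, one_mul, smul_mul_assoc]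
    abel
  have hPQ : P * Q = 0 := by rw [hQ, mul_sub, mul_one, hPP, sub_self]
  have hQR : Q * R = 0 := by rw [hQ, sub_mul, one_mul, hPR, sub_self]
  have hPN : P * N = N - Q := by
    have h : P * N = P + l • (B * N) := by
      conv_lhs => rw [hN, mul_add, mul_one, mul_smul_comm, ← mul_assoc, hPB]
    rw [h, hQ, eq_sub_iff_add_eq]
    conv_rhs => rw [hN]
    abel
  have hRN : R * N = R := by
    rw [hN, mul_add, mul_one, mul_smul_comm, ← mul_assoc, hRB, zero_mul, smul_zero, add_zero]
  have hPM : P * M = P := by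
    rw [hM, mul_add, mul_one, mul_smul_comm, ← mul_assoc, ← mul_assoc, hPDQ, zero_mul, smul_zero,
      add_zero]
  have hRMQ : R * (M * Q) = 0 := by
    rw [← hRP, mul_assoc, ← mul_assoc P, hPM, hPQ, mul_zero]
  have hQMQ : Q * (M * Q) = M * Q := by
    rw [hQ, sub_mul, one_mul, ← hQ, ← mul_assoc P, hPM, hPQ, sub_zero]
  have hDN : (D - l • 1) * N = D - l • Q := by
    have h : D * N = D + l • (P * N) := by
      conv_lhs => rw [hN, mul_add, mul_one, mul_smul_comm, ← mul_assoc, hDB]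
    rw [sub_mul, h, hPN, smul_mul_assoc, one_mul, smul_sub]
    abel
  have hDM : (D - l • 1) * (M * Q) = -(l • Q) := by
    have h : D * Q * M = l • (M - 1) := by
      rw [← eq_sub_of_add_eq' hM.symm, smul_smul, mul_inv_cancel₀ hl, one_smul]
    rw [sub_mul, ← hQMQ, ← mul_assoc, ← mul_assoc, h, hQMQ, smul_mul_assoc, sub_mul, one_mul,
      smul_mul_assoc, one_mul, smul_sub]
    abel
  have hDR : D * R = Q * (D * R) := by
    rw [hQ, sub_mul, one_mul, ← mul_assoc P, hPDR, sub_zero]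
  refine ⟨B * N * P - l⁻¹ • (M * Q), N + l⁻¹ • (M * D), ?_, ?_, ?_, ?_⟩
  · have h1 : (D - l • 1) * (B * N * P) = P := by
      have h2 : (D - l • 1) * (B * N) = P * N - (N - 1) := by
        rw [sub_mul, ← mul_assoc, hDB, smul_mul_assoc, one_mul]
        congr 1
        exact eq_sub_of_add_eq' hN.symm
      rw [← mul_assoc, h2, hPN, sub_sub_sub_cancel_left, sub_mul, one_mul]
      rw [hQ, sub_mul, one_mul, hPP, sub_self, sub_zero]
    rw [mul_sub, h1, mul_smul_comm, hDM, smul_neg, smul_smul, inv_mul_cancel₀ hl, one_smul,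
      sub_neg_eq_add, hQ]
    abel
  · have h1 : M * D * R = M * Q * (D * R) := by rw [mul_assoc, mul_assoc, ← hDR]
    rw [add_mul, mul_add, ← mul_assoc, hDN, smul_mul_assoc, h1, mul_smul_comm, ← mul_assoc, hDM,
      neg_mul, smul_neg, smul_mul_assoc, smul_smul, inv_mul_cancel₀ hl, one_smul, ← hDR, sub_mul,
      smul_mul_assoc, hQR, smul_zero, sub_zero, add_neg_cancel]
  · rw [mul_sub, ← mul_assoc, ← mul_assoc, hRB, mul_smul_comm, hRMQ]
    simp
  · have h1 : M * D * R = M * Q * (D * R) := by rw [mul_assoc, mul_assoc, ← hDR]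
    rw [add_mul, mul_add, ← mul_assoc, hRN, hRR, smul_mul_assoc, h1, mul_smul_comm, ← mul_assoc,
      hRMQ, zero_mul, smul_zero, add_zero]

end Universality

/-! ### Weighted dilations on the half-line -/

namespace HalfLine

open MeasureTheory LaguerreBasis

theorem map_mul_left {s : ℝ} (hs : 0 < s) :
    halfLine.map (s * ·) = ENNReal.ofReal s⁻¹ • halfLine := by
  have hpre : (s * ·) ⁻¹' Set.Ioi (0 : ℝ) = Set.Ioi 0 := by
    ext x
    simp [hs]
  have h := Measure.restrict_map (μ := volume) (measurable_const_mul s)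
    (measurableSet_Ioi (a := (0 : ℝ)))
  rw [hpre] at h
  rw [← h, Real.map_volume_mul_left hs.ne', abs_of_pos (inv_pos.2 hs), Measure.restrict_smul]

theorem quasiMeasurePreserving_mul_left {s : ℝ} (hs : 0 < s) :
    Measure.QuasiMeasurePreserving (s * ·) halfLine halfLine :=
  ⟨measurable_const_mul s, by
    rw [map_mul_left hs]
    exact Measure.smul_absolutelyContinuous⟩

theorem integral_comp_mul_left {s : ℝ} (hs : 0 < s) (f : ℝ → ℂ) :
    ∫ x, f (s * x) ∂halfLine = (s⁻¹ : ℂ) * ∫ x, f x ∂halfLine := by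
  rw [integral_comp_mul_left_Ioi f 0 hs, mul_zero, Complex.real_smul, Complex.ofReal_inv]

theorem memLp_comp_mul_left {s : ℝ} (hs : 0 < s) {k : ℝ → ℂ} (hk : MemLp k 2 halfLine) :
    MemLp (fun x => k (s * x)) 2 halfLine := by
  have h : MemLp k 2 (halfLine.map (s * ·)) := by
    rw [map_mul_left hs]
    exact hk.smul_measure ENNReal.ofReal_ne_top
  exact (memLp_map_measure_iff h.1 (measurable_const_mul s).aemeasurable).1 h

/-- A measurable function that is bounded on the half-line. -/
structure IsBoundedWeight (w : ℝ → ℂ) : Prop where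
  measurable : Measurable w
  bdd : ∃ b : ℝ, ∀ x, 0 < x → ‖w x‖ ≤ b

theorem memLp_weighted {w : ℝ → ℂ} (hw : IsBoundedWeight w) {s : ℝ} (hs : 0 < s) {k : ℝ → ℂ}
    (hk : MemLp k 2 halfLine) : MemLp (fun x => w x * k (s * x)) 2 halfLine := by
  obtain ⟨b, hb⟩ := hw.bdd
  refine (memLp_comp_mul_left hs hk).of_le_mul (c := b)
    (hw.measurable.aestronglyMeasurable.mul (memLp_comp_mul_left hs hk).1) ?_
  filter_upwards [ae_restrict_mem measurableSet_Ioi] with x hx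
  rw [norm_mul]
  exact mul_le_mul_of_nonneg_right (hb x hx) (norm_nonneg _)

theorem norm_weighted_le {w : ℝ → ℂ} (hw : IsBoundedWeight w) {s : ℝ} (hs : 0 < s) {b : ℝ}
    (hb0 : 0 ≤ b) (hb : ∀ x, 0 < x → ‖w x‖ ≤ b) (k : Lp ℂ 2 halfLine) :
    ‖(memLp_weighted hw hs (Lp.memLp k)).toLp‖ ≤ b * s ^ (-(1 / 2) : ℝ) * ‖k‖ := by
  have hm := memLp_weighted hw hs (Lp.memLp k)
  have hs' : (s ^ (-(1 / 2) : ℝ)) ^ 2 = s⁻¹ := by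
    rw [← Real.rpow_natCast, ← Real.rpow_mul hs.le]
    norm_num [Real.rpow_neg_one]
  refine abs_le_of_sq_le_sq' ?_ (by positivity) |>.2
  have h1 : ∫ x, ‖k (s * x)‖ ^ 2 ∂halfLine = s⁻¹ * ‖k‖ ^ 2 := by
    rw [← integral_norm_sq, integral_comp_mul_left_Ioi (fun x => ‖k x‖ ^ 2) 0 hs, mul_zero,
      smul_eq_mul]
  have h2 : ‖hm.toLp‖ ^ 2 = ∫ x, ‖w x * k (s * x)‖ ^ 2 ∂halfLine := by
    rw [← integral_norm_sq]
    refine integral_congr_ae ?_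
    filter_upwards [hm.coeFn_toLp] with x hx
    rw [hx]
  rw [h2, mul_pow, mul_pow, hs', mul_assoc, ← h1, ← integral_const_mul]
  refine integral_mono_ae (hm.integrable_norm_pow (p := 2) (by norm_num))
    (((memLp_comp_mul_left hs (Lp.memLp k)).integrable_norm_pow (p := 2)
      (by norm_num)).const_mul _) ?_
  filter_upwards [ae_restrict_mem measurableSet_Ioi] with x hx
  have := hb x hx
  rw [norm_mul, mul_pow]
  gcongr

/-- The bounded operator `k ↦ w(x) k(s x)` on `L²(0, ∞)`. -/
noncomputable def weightedDilation {w : ℝ → ℂ} (hw : IsBoundedWeight w) {s : ℝ} (hs : 0 < s) :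
    Lp ℂ 2 halfLine →L[ℂ] Lp ℂ 2 halfLine :=
  LinearMap.mkContinuousOfExistsBound
    { toFun := fun k => (memLp_weighted hw hs (Lp.memLp k)).toLp
      map_add' := fun k l => by
        rw [← MemLp.toLp_add]
        refine MemLp.toLp_congr _ _ ?_
        filter_upwards [(quasiMeasurePreserving_mul_left hs).ae (Lp.coeFn_add k l)] with x hx
        rw [hx, Pi.add_apply, mul_add, Pi.add_apply]
      map_smul' := fun c k => by
        rw [RingHom.id_apply, ← MemLp.toLp_const_smul]
        refine MemLp.toLp_congr _ _ ?_
        filter_upwards [(quasiMeasurePreserving_mul_left hs).ae (Lp.coeFn_smul c k)] with x hx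
        rw [hx, Pi.smul_apply, Pi.smul_apply, smul_eq_mul, smul_eq_mul, mul_left_comm] }
    (by
      obtain ⟨b, hb⟩ := hw.bdd
      exact ⟨_, norm_weighted_le hw hs ((norm_nonneg _).trans (hb 1 one_pos)) hb⟩)

variable {w w' : ℝ → ℂ} {s s' : ℝ}

theorem coeFn_weightedDilation (hw : IsBoundedWeight w) (hs : 0 < s) (k : Lp ℂ 2 halfLine) :
    weightedDilation hw hs k =ᵐ[halfLine] fun x => w x * k (s * x) :=
  (memLp_weighted hw hs (Lp.memLp k)).coeFn_toLp

theorem norm_weightedDilation_le (hw : IsBoundedWeight w) (hs : 0 < s) {b : ℝ} (hb0 : 0 ≤ b)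
    (hb : ∀ x, 0 < x → ‖w x‖ ≤ b) : ‖weightedDilation hw hs‖ ≤ b * s ^ (-(1 / 2) : ℝ) :=
  ContinuousLinearMap.opNorm_le_bound _ (by positivity) (norm_weighted_le hw hs hb0 hb)

theorem weightedDilation_congr (hw : IsBoundedWeight w) (hw' : IsBoundedWeight w') (hs : 0 < s)
    (hs' : 0 < s') (hss : s = s') (h : ∀ x, 0 < x → w x = w' x) :
    weightedDilation hw hs = weightedDilation hw' hs' := by
  subst hss
  ext1 k
  refine Lp.ext ?_
  filter_upwards [coeFn_weightedDilation hw hs k, coeFn_weightedDilation hw' hs' k,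
    ae_restrict_mem measurableSet_Ioi] with x h1 h2 hx
  rw [h1, h2, h x hx]

theorem isBoundedWeight_comp (hw : IsBoundedWeight w) (hw' : IsBoundedWeight w') (hs : 0 < s) :
    IsBoundedWeight fun x => w x * w' (s * x) := by
  refine ⟨hw.measurable.mul (hw'.measurable.comp (measurable_const_mul s)), ?_⟩
  obtain ⟨b, hb⟩ := hw.bdd
  obtain ⟨b', hb'⟩ := hw'.bdd
  refine ⟨b * b', fun x hx => ?_⟩
  rw [norm_mul]
  exact mul_le_mul (hb x hx) (hb' _ (mul_pos hs hx)) (norm_nonneg _)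
    ((norm_nonneg _).trans (hb x hx))

theorem weightedDilation_mul (hw : IsBoundedWeight w) (hw' : IsBoundedWeight w') (hs : 0 < s)
    (hs' : 0 < s') :
    weightedDilation hw hs * weightedDilation hw' hs' =
      weightedDilation (isBoundedWeight_comp hw hw' hs) (mul_pos hs' hs) := by
  ext1 k
  refine Lp.ext ?_
  filter_upwards [coeFn_weightedDilation hw hs (weightedDilation hw' hs' k),
    (quasiMeasurePreserving_mul_left hs).ae (coeFn_weightedDilation hw' hs' k),
    coeFn_weightedDilation (isBoundedWeight_comp hw hw' hs) (mul_pos hs' hs) k] with x h1 h2 h3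
  rw [mul_apply_eq_comp, h1, h2, h3, mul_assoc, mul_assoc]

theorem weightedDilation_eq_one (hw : IsBoundedWeight w) (hs : 0 < s) (hs1 : s = 1)
    (h : ∀ x, 0 < x → w x = 1) : weightedDilation hw hs = 1 := by
  subst hs1
  ext1 k
  refine Lp.ext ?_
  filter_upwards [coeFn_weightedDilation hw hs k, ae_restrict_mem measurableSet_Ioi] with x h1 hx
  rw [h1, h x hx, one_mul, one_mul, one_apply_eq_self]

theorem weightedDilation_eq_zero (hw : IsBoundedWeight w) (hs : 0 < s)
    (h : ∀ x, 0 < x → w x = 0) : weightedDilation hw hs = 0 := by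
  ext1 k
  refine Lp.ext ?_
  filter_upwards [coeFn_weightedDilation hw hs k, ae_restrict_mem measurableSet_Ioi,
    Lp.coeFn_zero ℂ 2 halfLine] with x h1 hx h0
  rw [h1, h x hx, zero_mul, zero_apply, h0, Pi.zero_apply]

theorem weightedDilation_add (hw : IsBoundedWeight w) (hw' : IsBoundedWeight w')
    {v : ℝ → ℂ} (hv : IsBoundedWeight v) (hs : 0 < s) (h : ∀ x, 0 < x → w x + w' x = v x) :
    weightedDilation hw hs + weightedDilation hw' hs = weightedDilation hv hs := by
  ext1 k
  refine Lp.ext ?_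
  filter_upwards [coeFn_weightedDilation hw hs k, coeFn_weightedDilation hw' hs k,
    coeFn_weightedDilation hv hs k, ae_restrict_mem measurableSet_Ioi,
    Lp.coeFn_add (weightedDilation hw hs k) (weightedDilation hw' hs k)] with x h1 h2 h3 hx h4
  rw [add_apply, h4, Pi.add_apply, h1, h2, h3, ← h x hx, add_mul]

end HalfLine

/-! ### Splitting a weighted dilation at a level -/

namespace HalfLine

open MeasureTheory LaguerreBasis

/-- The weight `exp (-κ (ρ(x) - ρ(a x)))` with `ρ(x) = max (x - c) 0`. It is `1` below the level
`c` and `exp (-κ (1 - a) x)` as soon as `a x ≥ c`. -/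
noncomputable def levelWeight (κ : ℂ) (a c : ℝ) (x : ℝ) : ℂ :=
  Complex.exp (-κ * ((max (x - c) 0 - max (a * x - c) 0 : ℝ) : ℂ))

theorem norm_levelWeight (κ : ℂ) (a c x : ℝ) :
    ‖levelWeight κ a c x‖ = Real.exp (-κ.re * (max (x - c) 0 - max (a * x - c) 0)) := by
  rw [levelWeight, Complex.norm_exp, Complex.re_mul_ofReal, Complex.neg_re]

theorem norm_levelWeight_le_one {κ : ℂ} (hκ : 0 < κ.re) {a : ℝ} (ha1 : a < 1) (c : ℝ) {x : ℝ}
    (hx : 0 < x) : ‖levelWeight κ a c x‖ ≤ 1 := by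
  rw [norm_levelWeight, Real.exp_le_one_iff]
  have h1 : a * x ≤ x := by nlinarith
  have h2 : max (a * x - c) 0 ≤ max (x - c) 0 := max_le_max (by linarith) le_rfl
  nlinarith

theorem isBoundedWeight_levelWeight {κ : ℂ} (hκ : 0 < κ.re) {a : ℝ} (ha1 : a < 1) (c : ℝ) :
    IsBoundedWeight (levelWeight κ a c) := by
  refine ⟨Continuous.measurable ?_, 1, fun x hx => norm_levelWeight_le_one hκ ha1 c hx⟩
  unfold levelWeight
  fun_prop

theorem isBoundedWeight_indicator {S : Set ℝ} (hS : MeasurableSet S) :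
    IsBoundedWeight (S.indicator 1) := by
  refine ⟨measurable_one.indicator hS, 1, fun x _ => ?_⟩
  refine (norm_indicator_le_norm_self _ x).trans ?_
  simp

/-- The operator `k ↦ ω(x) k(a x)` on `L²(0, ∞)` with the weight `ω = levelWeight κ a c`. -/
noncomputable def levelDilation {κ : ℂ} (hκ : 0 < κ.re) {a : ℝ} (ha0 : 0 < a) (ha1 : a < 1)
    (c : ℝ) : Lp ℂ 2 halfLine →L[ℂ] Lp ℂ 2 halfLine :=
  weightedDilation (isBoundedWeight_levelWeight hκ ha1 c) ha0

/-- Multiplication by the indicator function of `S` on `L²(0, ∞)`. -/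
noncomputable def cutoff {S : Set ℝ} (hS : MeasurableSet S) :
    Lp ℂ 2 halfLine →L[ℂ] Lp ℂ 2 halfLine :=
  weightedDilation (isBoundedWeight_indicator hS) one_pos

theorem one_sub_cutoff {S : Set ℝ} (hS : MeasurableSet S) : 1 - cutoff hS = cutoff hS.compl := by
  rw [sub_eq_iff_eq_add, cutoff, cutoff,
    weightedDilation_add (v := 1) _ _ ⟨measurable_one, 1, by simp⟩ one_pos fun x _ => by
      by_cases h : x ∈ S <;> simp [h],
    weightedDilation_eq_one _ _ rfl fun _ _ => rfl]

theorem cutoff_mul_cutoff {S S' : Set ℝ} (hS : MeasurableSet S) (hS' : MeasurableSet S') :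
    cutoff hS * cutoff hS' = cutoff (hS.inter hS') := by
  rw [cutoff, cutoff, weightedDilation_mul]
  refine weightedDilation_congr _ _ _ _ (one_mul 1) fun x _ => ?_
  by_cases h : x ∈ S <;> by_cases h' : x ∈ S' <;> simp [h, h']

theorem cutoff_congr {S S' : Set ℝ} (hS : MeasurableSet S) (hS' : MeasurableSet S')
    (h : ∀ x, 0 < x → (x ∈ S ↔ x ∈ S')) : cutoff hS = cutoff hS' :=
  weightedDilation_congr _ _ _ _ rfl fun x hx => by
    by_cases hxS : x ∈ S
    · simp [hxS, (h x hx).1 hxS]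
    · have : x ∉ S' := fun h' => hxS ((h x hx).2 h')
      simp [hxS, this]

/-- There is an isometric copy of `ℓ²` in `L²(0, ∞)` that lives on a given bounded interval. -/
theorem exists_isometry_cutoff_Ioc {u v : ℝ} (hu : 0 ≤ u) (huv : u < v) :
    ∃ ι : lp (fun _ : ℕ => ℂ) 2 →ₗᵢ[ℂ] Lp ℂ 2 halfLine,
      ∀ x, cutoff (measurableSet_Ioc (a := u) (b := v)) (ι x) = ι x := by
  -- consecutive intervals between the points `v - (v - u) / (n + 1)`
  let p : ℕ → ℝ := fun n => v - (v - u) / (n + 1)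
  have hlt : ∀ n, p n < p (n + 1) := fun n => by
    have h1 : (0 : ℝ) < n + 1 := by positivity
    have h2 : (0 : ℝ) < v - u := sub_pos.2 huv
    have : (v - u) / ((n + 1 : ℕ) + 1 : ℝ) < (v - u) / (n + 1) := by
      apply div_lt_div_of_pos_left h2 h1
      push_cast
      linarith
    simp only [p]
    linarith
  have hmono : Monotone p := monotone_nat_of_le_succ fun n => (hlt n).le
  have hpu : ∀ n, u ≤ p n := fun n => by
    have := hmono (Nat.zero_le n)
    simp only [p, Nat.cast_zero, zero_add, div_one] at this ⊢
    linarith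
  have hpv : ∀ n, p n ≤ v := fun n => by
    have h2 : (0 : ℝ) < v - u := sub_pos.2 huv
    have : 0 ≤ (v - u) / ((n : ℝ) + 1) := by positivity
    simp only [p]
    linarith
  let I : ℕ → Set ℝ := fun n => Set.Ioc (p n) (p (n + 1))
  have hIm : ∀ n, MeasurableSet (I n) := fun n => measurableSet_Ioc
  have hvol : ∀ n, halfLine (I n) = ENNReal.ofReal (p (n + 1) - p n) := fun n => by
    rw [Measure.restrict_apply (hIm n), Set.inter_eq_left.2, Real.volume_Ioc]
    exact fun x hx => lt_of_le_of_lt (hu.trans (hpu n)) hx.1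
  have hfin : ∀ n, halfLine (I n) ≠ ⊤ := fun n => by
    rw [hvol]
    exact ENNReal.ofReal_ne_top
  have hreal : ∀ n, halfLine.real (I n) = p (n + 1) - p n := fun n => by
    rw [Measure.real, hvol, ENNReal.toReal_ofReal (sub_nonneg.2 (hlt n).le)]
  let e : ℕ → Lp ℂ 2 halfLine := fun n =>
    indicatorConstLp 2 (hIm n) (hfin n) ((Real.sqrt (p (n + 1) - p n))⁻¹ : ℂ)
  have hdisj : Pairwise (Function.onFun Disjoint I) := hmono.pairwise_disjoint_on_Ioc_succ
  have he : Orthonormal ℂ e := by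
    constructor
    · intro n
      have h3 : 0 < p (n + 1) - p n := sub_pos.2 (hlt n)
      simp only [e]
      rw [norm_indicatorConstLp (by norm_num) (by norm_num), hreal, norm_inv, Complex.norm_real,
        Real.norm_of_nonneg (Real.sqrt_nonneg _), Real.sqrt_eq_rpow]
      norm_num
      exact inv_mul_cancel₀ (by positivity)
    · intro m n hmn
      simp only [e]
      rw [L2.inner_indicatorConstLp_eq_inner_setIntegral]
      have : ∫ x in I m, indicatorConstLp 2 (hIm n) (hfin n)
          ((Real.sqrt (p (n + 1) - p n))⁻¹ : ℂ) x ∂halfLine = 0 := by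
        rw [setIntegral_indicatorConstLp (hIm m), (hdisj hmn.symm).inter_eq]
        simp
      rw [this, inner_zero_right]
  have hcut : ∀ n, cutoff (measurableSet_Ioc (a := u) (b := v)) (e n) = e n := fun n => by
    refine Lp.ext ?_
    have h1 := indicatorConstLp_coeFn (p := 2) (hs := hIm n) (hμs := hfin n)
      (c := ((Real.sqrt (p (n + 1) - p n))⁻¹ : ℂ))
    filter_upwards [coeFn_weightedDilation (isBoundedWeight_indicator
      (measurableSet_Ioc (a := u) (b := v))) one_pos (e n), h1] with x h2 h3
    rw [cutoff, h2, one_mul]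
    simp only [e]
    rw [h3]
    by_cases hx : x ∈ I n
    · have : x ∈ Set.Ioc u v := ⟨(hpu n).trans_lt hx.1, hx.2.trans (hpv _)⟩
      simp [this]
    · simp [hx]
  refine ⟨he.orthogonalFamily.linearIsometry, fun x => ?_⟩
  have hs := he.orthogonalFamily.hasSum_linearIsometry x
  refine ((cutoff measurableSet_Ioc).hasSum hs).unique (hs.congr_fun fun n => ?_)
  simp only [LinearIsometry.toSpanSingleton_apply, map_smul, hcut]

/-- For a suitable level `c`, the operator `D - λ` satisfies the hypotheses of Caradus' criterion:
below the level `D` is a plain dilation, with an inverse of norm `a^{1/2} < 1 / |λ|`, and above the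
level its norm is less than `|λ|`. -/
theorem exists_level_rightInverse {κ : ℂ} (hκ : 0 < κ.re) {a : ℝ} (ha0 : 0 < a) (ha1 : a < 1)
    {l : ℂ} (hl0 : 0 < ‖l‖) (hl : ‖l‖ < a ^ (-(1 / 2) : ℝ)) :
    ∃ c : ℝ, 0 < c ∧ ∃ (W : Lp ℂ 2 halfLine →L[ℂ] Lp ℂ 2 halfLine)
      (V : lp (fun _ : ℕ => ℂ) 2 →L[ℂ] Lp ℂ 2 halfLine)
      (J : Lp ℂ 2 halfLine →L[ℂ] lp (fun _ : ℕ => ℂ) 2),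
      (levelDilation hκ ha0 ha1 c - l • 1) ∘L V = 0 ∧
      (levelDilation hκ ha0 ha1 c - l • 1) ∘L W = .id ℂ _ ∧
      J ∘L V = .id ℂ _ ∧ J ∘L W = 0 := by
  have hs0 : 0 < a ^ (-(1 / 2) : ℝ) := Real.rpow_pos_of_pos ha0 _
  -- the level: `|λ|⁻¹ a^{-1/2} exp (-Re κ (1 - a) c) < 1`
  obtain ⟨c, hc0, hc⟩ : ∃ c : ℝ, 0 < c ∧
      ‖l‖⁻¹ * (Real.exp (-κ.re * ((1 - a) * c)) * a ^ (-(1 / 2) : ℝ)) < 1 := by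
    have hpos : 0 < κ.re * (1 - a) := mul_pos hκ (by linarith)
    have hlim : Filter.Tendsto (fun c : ℝ => ‖l‖⁻¹ *
        (Real.exp (-(κ.re * (1 - a) * c)) * a ^ (-(1 / 2) : ℝ))) Filter.atTop
        (nhds (‖l‖⁻¹ * (0 * a ^ (-(1 / 2) : ℝ)))) :=
      ((Real.tendsto_exp_neg_atTop_nhds_zero.comp
        (Filter.tendsto_id.const_mul_atTop hpos)).mul_const _).const_mul _
    rw [zero_mul, mul_zero] at hlim
    obtain ⟨c, h1, h2⟩ :=
      ((hlim.eventually_lt_const one_pos).and (Filter.eventually_gt_atTop 0)).exists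
    refine ⟨c, h2, ?_⟩
    have h3 : -κ.re * ((1 - a) * c) = -(κ.re * (1 - a) * c) := by ring
    rw [h3]
    exact h1
  have hac : a * c < c := by nlinarith
  have hac0 : 0 < a * c := mul_pos ha0 hc0
  set D := levelDilation hκ ha0 ha1 c with hD
  let B := weightedDilation (isBoundedWeight_indicator (measurableSet_Iic (a := a * c)))
    (inv_pos.2 ha0)
  let P := cutoff (measurableSet_Iic (a := c))
  let R := cutoff (measurableSet_Ioc (a := a * c) (b := c))
  have hQ : 1 - P = cutoff (measurableSet_Iic (a := c)).compl := one_sub_cutoff _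
  obtain ⟨W, K, hW, hK, hRW, hRK⟩ : ∃ W K : Lp ℂ 2 halfLine →L[ℂ] Lp ℂ 2 halfLine,
      (D - l • 1) * W = 1 ∧ (D - l • 1) * (K * R) = 0 ∧ R * W = 0 ∧ R * (K * R) = R := by
    refine exists_rightInverse_of_split (B := B) (P := P) (norm_pos_iff.1 hl0) ?_ ?_ ?_ ?_ ?_ ?_ ?_
      ?_ ?_ ?_ ?_
    · -- `D B = P`
      simp only [D, B, P, levelDilation, cutoff]
      rw [weightedDilation_mul]
      refine weightedDilation_congr _ _ _ _ (inv_mul_cancel₀ ha0.ne') fun x hx => ?_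
      by_cases h : x ≤ c
      · have h1 : a * x ≤ a * c := mul_le_mul_of_nonneg_left h ha0.le
        have h2 : levelWeight κ a c x = 1 := by
          rw [levelWeight, max_eq_right (by linarith), max_eq_right (by nlinarith)]
          simp
        simp [h, h1, h2]
      · have h1 : ¬ a * x ≤ a * c := fun h' => h (le_of_mul_le_mul_left h' ha0)
        simp only [Set.indicator, Set.mem_Iic, h, h1, if_false, mul_zero]
    · -- `P B = B`
      simp only [B, P, cutoff]
      rw [weightedDilation_mul]
      refine weightedDilation_congr _ _ _ _ (mul_one _) fun x hx => ?_
      by_cases h : x ≤ a * c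
      · simp [h, h.trans hac.le]
      · simp [h]
    · -- `R B = 0`
      simp only [B, R, cutoff]
      rw [weightedDilation_mul]
      refine weightedDilation_eq_zero _ _ fun x hx => ?_
      by_cases h : x ≤ a * c
      · simp [h.not_gt]
      · simp [h]
    · rw [cutoff_mul_cutoff]
      exact cutoff_congr _ _ fun x _ => by simp
    · rw [cutoff_mul_cutoff]
      exact cutoff_congr _ _ fun x _ => by simp
    · rw [cutoff_mul_cutoff]
      exact cutoff_congr _ _ fun x _ => by simp
    · rw [cutoff_mul_cutoff]
      exact cutoff_congr _ _ fun x _ => by simp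
    · -- `P D (1 - P) = 0`
      rw [hQ]
      simp only [D, P, levelDilation, cutoff]
      rw [weightedDilation_mul, weightedDilation_mul]
      refine weightedDilation_eq_zero _ _ fun x hx => ?_
      by_cases h : x ≤ c
      · have : a * x ≤ c := by nlinarith
        simp [this]
      · simp [h]
    · -- `P D R = 0`
      simp only [D, P, R, levelDilation, cutoff]
      rw [weightedDilation_mul, weightedDilation_mul]
      refine weightedDilation_eq_zero _ _ fun x hx => ?_
      by_cases h : x ≤ c
      · have : ¬ a * c < a * x := not_lt.2 (mul_le_mul_of_nonneg_left h ha0.le)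
        simp [this]
      · simp [h]
    · refine (ContinuousLinearMap.opNorm_smul_le l B).trans_lt ?_
      have h1 : ‖B‖ ≤ 1 * (a⁻¹) ^ (-(1 / 2) : ℝ) :=
        norm_weightedDilation_le _ _ zero_le_one fun x _ =>
          (norm_indicator_le_norm_self _ x).trans (by simp)
      rw [one_mul, Real.inv_rpow ha0.le] at h1
      calc ‖l‖ * ‖B‖ ≤ ‖l‖ * (a ^ (-(1 / 2) : ℝ))⁻¹ := by gcongr
        _ < 1 := by rwa [← div_eq_mul_inv, div_lt_one hs0]
    · refine (ContinuousLinearMap.opNorm_smul_le l⁻¹ (D * (1 - P))).trans_lt ?_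
      rw [hQ]
      simp only [D, levelDilation, cutoff]
      rw [weightedDilation_mul, norm_inv]
      refine lt_of_le_of_lt ?_ hc
      gcongr
      refine (norm_weightedDilation_le _ _ (Real.exp_nonneg (-κ.re * ((1 - a) * c)))
        fun x hx => ?_).trans_eq (by rw [one_mul])
      by_cases h : a * x ≤ c
      · simp [h, Real.exp_nonneg]
      · have h1 : c < a * x := not_le.1 h
        have h2 : a * x ≤ x := by nlinarith
        rw [norm_mul, norm_levelWeight, max_eq_left (by linarith), max_eq_left (by linarith)]
        have h3 : ‖((Set.Iic c)ᶜ).indicator (1 : ℝ → ℂ) (a * x)‖ ≤ 1 :=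
          (norm_indicator_le_norm_self _ _).trans (by simp)
        refine (mul_le_of_le_one_right (Real.exp_nonneg _) h3).trans (Real.exp_le_exp.2 ?_)
        have h4 : (1 - a) * c ≤ (1 - a) * x := by
          apply mul_le_mul_of_nonneg_left _ (by linarith)
          linarith
        nlinarith
  obtain ⟨ι, hι⟩ := exists_isometry_cutoff_Ioc hac0.le hac
  have hιι : ContinuousLinearMap.adjoint ι.toContinuousLinearMap ∘L ι.toContinuousLinearMap =
      .id ℂ _ := ContinuousLinearMap.norm_map_iff_adjoint_comp_self _ |>.1 ι.norm_map
  have hRι : R ∘L ι.toContinuousLinearMap = ι.toContinuousLinearMap :=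
    ContinuousLinearMap.ext hι
  have hRK' : R ∘L K ∘L R = R := hRK
  have hK' : (D - l • 1) ∘L K ∘L R = 0 := hK
  have hRW' : R ∘L W = 0 := hRW
  refine ⟨c, hc0, W, K ∘L R ∘L ι.toContinuousLinearMap,
    ContinuousLinearMap.adjoint ι.toContinuousLinearMap ∘L R, ?_, hW, ?_, ?_⟩
  · have : (D - l • 1) ∘L K ∘L R ∘L ι.toContinuousLinearMap =
      ((D - l • 1) ∘L K ∘L R) ∘L ι.toContinuousLinearMap := rfl
    rw [this, hK', ContinuousLinearMap.zero_comp]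
  · have : (ContinuousLinearMap.adjoint ι.toContinuousLinearMap ∘L R) ∘L
        K ∘L R ∘L ι.toContinuousLinearMap =
      ContinuousLinearMap.adjoint ι.toContinuousLinearMap ∘L
        (R ∘L K ∘L R) ∘L ι.toContinuousLinearMap := rfl
    rw [this, hRK', hRι, hιι]
  · rw [ContinuousLinearMap.comp_assoc, hRW', ContinuousLinearMap.comp_zero]

end HalfLine

/-! ### Weighted rotations of the Hardy space -/

namespace HardySpace

open HardyDisc

/-- A function `u` that is holomorphic and bounded on the unit disc. -/
structure IsMultiplier (u : ℂ → ℂ) : Prop where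
  holo : DifferentiableOn ℂ u (Metric.ball 0 1)
  bdd : ∃ b : ℝ, ∀ z, ‖z‖ < 1 → ‖u z‖ ≤ b

theorem integralMean_mul_le {u f : ℂ → ℂ} (hu : DifferentiableOn ℂ u (Metric.ball 0 1)) {b : ℝ}
    (hb0 : 0 ≤ b) (hb : ∀ z, ‖z‖ < 1 → ‖u z‖ ≤ b) (hf : DifferentiableOn ℂ f (Metric.ball 0 1))
    {r : ℝ} (hr : r ∈ Set.Ico (0 : ℝ) 1) :
    integralMean (fun z => u z * f z) r ≤ b * integralMean f r := by
  have h1 : b * integralMean f r = integralMean ((b : ℂ) • f) r := by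
    rw [integralMean_smul, Complex.norm_real, Real.norm_of_nonneg hb0]
  rw [h1, integralMean, integralMean]
  refine Real.sqrt_le_sqrt (Real.circleAverage_mono ?_ ?_ fun z hz => ?_)
  · exact ((continuous_circle (hu.mul hf) hr).norm.pow 2).intervalIntegrable _ _
  · exact ((continuous_circle (hf.const_smul (b : ℂ)) hr).norm.pow 2).intervalIntegrable _ _
  · have hz' : ‖z‖ < 1 := by
      rw [mem_sphere_zero_iff_norm, abs_of_nonneg hr.1] at hz
      rw [hz]
      exact hr.2
    simp only [Pi.smul_apply, smul_eq_mul, norm_mul, Complex.norm_real, Real.norm_of_nonneg hb0]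
    gcongr
    exact hb z hz'

theorem differentiableOn_rotate {f : ℂ → ℂ} (hf : DifferentiableOn ℂ f (Metric.ball 0 1)) {ζ : ℂ}
    (hζ : ‖ζ‖ = 1) : DifferentiableOn ℂ (fun z => f (ζ * z)) (Metric.ball 0 1) :=
  hf.comp (by fun_prop) fun z hz => by simpa [hζ] using hz

theorem integralMean_rotate {f : ℂ → ℂ} (hf : DifferentiableOn ℂ f (Metric.ball 0 1)) {ζ : ℂ}
    (hζ : ‖ζ‖ = 1) {r : ℝ} (hr : r ∈ Set.Ico (0 : ℝ) 1) :
    integralMean (fun z => f (ζ * z)) r = integralMean f r := by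
  have h1 := hasSum_sq_integralMean (fun z hz => hasSum_taylor hf hz) hr
  have h2 : ∀ z : ℂ, ‖z‖ < 1 → HasSum
      (fun n : ℕ => ((n.factorial : ℂ)⁻¹ * iteratedDeriv n f 0 * ζ ^ n) * z ^ n) (f (ζ * z)) :=
    fun z hz => (hasSum_taylor hf (z := ζ * z) (by simpa [hζ] using hz)).congr_fun fun n => by
      rw [mul_pow]
      ring
  have h3 := hasSum_sq_integralMean h2 hr
  simp only [norm_mul _ (ζ ^ _), norm_pow, hζ, one_pow, mul_one] at h3
  exact (pow_left_inj₀ (integralMean_nonneg _ _) (integralMean_nonneg _ _) two_ne_zero).1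
    (h3.unique h1)

theorem integralMean_weightedRotation_le {u : ℂ → ℂ} (hu : DifferentiableOn ℂ u (Metric.ball 0 1))
    {b : ℝ} (hb0 : 0 ≤ b) (hb : ∀ z, ‖z‖ < 1 → ‖u z‖ ≤ b) {ζ : ℂ} (hζ : ‖ζ‖ = 1)
    (f : HardySpace) {r : ℝ} (hr : r ∈ Set.Ico (0 : ℝ) 1) :
    integralMean (fun z => u z * f (ζ * z)) r ≤ b * ‖f‖ := by
  refine (integralMean_mul_le hu hb0 hb (differentiableOn_rotate f.isHardy.holo hζ) hr).trans ?_
  rw [integralMean_rotate f.isHardy.holo hζ hr]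
  exact mul_le_mul_of_nonneg_left (f.integralMean_le_norm hr) hb0

theorem isHardy_weightedRotation {u : ℂ → ℂ} (hu : IsMultiplier u) {ζ : ℂ} (hζ : ‖ζ‖ = 1)
    (f : HardySpace) : IsHardy fun z => u z * f (ζ * z) := by
  obtain ⟨b, hb⟩ := hu.bdd
  refine ⟨hu.holo.mul (differentiableOn_rotate f.isHardy.holo hζ), fun z hz => ?_, b * ‖f‖, ?_⟩
  · have : ζ * z ∉ Metric.ball (0 : ℂ) 1 := by simpa [hζ] using hz
    rw [f.isHardy.eq_zero _ this, mul_zero]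
  · rintro _ ⟨r, hr, rfl⟩
    exact integralMean_weightedRotation_le hu.holo ((norm_nonneg _).trans (hb 0 (by simp))) hb hζ
      f hr

/-- The bounded operator `f ↦ u(z) f(ζ z)` on `H²(𝔻)`, for a multiplier `u` and `|ζ| = 1`. -/
noncomputable def weightedRotation {u : ℂ → ℂ} (hu : IsMultiplier u) {ζ : ℂ} (hζ : ‖ζ‖ = 1) :
    HardySpace →L[ℂ] HardySpace :=
  LinearMap.mkContinuousOfExistsBound
    { toFun := fun f => ⟨fun z => u z * f (ζ * z), isHardy_weightedRotation hu hζ f⟩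
      map_add' := fun f g => Subtype.ext (funext fun z => mul_add _ _ _)
      map_smul' := fun c f => Subtype.ext (funext fun z => mul_left_comm _ _ _) }
    (by
      obtain ⟨b, hb⟩ := hu.bdd
      exact ⟨b, fun f => norm_le_of_forall _ fun r hr => integralMean_weightedRotation_le hu.holo
        ((norm_nonneg _).trans (hb 0 (by simp))) hb hζ f hr⟩)

theorem weightedRotation_apply {u : ℂ → ℂ} (hu : IsMultiplier u) {ζ : ℂ} (hζ : ‖ζ‖ = 1)
    (f : HardySpace) (z : ℂ) : weightedRotation hu hζ f z = u z * f (ζ * z) := rfl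

/-- Weighted rotations with multipliers `u`, `v` such that `u(z) v(ζ z) = 1` are inverse to each
other. -/
noncomputable def weightedRotationEquiv {u v : ℂ → ℂ} (hu : IsMultiplier u) (hv : IsMultiplier v)
    {ζ ξ : ℂ} (hζ : ‖ζ‖ = 1) (hξ : ‖ξ‖ = 1) (h : ξ * ζ = 1)
    (huv : ∀ z, ‖z‖ < 1 → u z * v (ζ * z) = 1) : HardySpace ≃L[ℂ] HardySpace :=
  ContinuousLinearEquiv.equivOfInverse (weightedRotation hu hζ) (weightedRotation hv hξ)
    (fun f => ext_disc fun z hz => by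
      have h1 := huv (ξ * z) (by simpa [hξ] using hz)
      rw [weightedRotation_apply, weightedRotation_apply, ← mul_assoc, ← mul_assoc, mul_comm ζ, h,
        one_mul]
      rw [← mul_assoc, mul_comm ζ, h, one_mul] at h1
      rw [mul_comm (v z), h1, one_mul])
    (fun f => ext_disc fun z hz => by
      rw [weightedRotation_apply, weightedRotation_apply, ← mul_assoc, huv z hz, one_mul,
        ← mul_assoc, h, one_mul])

theorem isMultiplier_one_sub_mul (q : ℂ) : IsMultiplier fun z => 1 - q * z := by
  refine ⟨by fun_prop, 1 + ‖q‖, fun z hz => (norm_sub_le _ _).trans ?_⟩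
  rw [norm_one, norm_mul]
  gcongr
  exact mul_le_of_le_one_right (norm_nonneg q) hz.le

theorem isMultiplier_inv_one_sub_mul {q : ℂ} (hq : ‖q‖ < 1) :
    IsMultiplier fun z => (1 - q * z)⁻¹ := by
  have hlow : ∀ z : ℂ, ‖z‖ < 1 → 1 - ‖q‖ ≤ ‖1 - q * z‖ := fun z hz => by
    have h1 := norm_sub_norm_le 1 (q * z)
    have h2 : ‖q‖ * ‖z‖ ≤ ‖q‖ := mul_le_of_le_one_right (norm_nonneg q) hz.le
    rw [norm_one, norm_mul] at h1
    linarith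
  have hpos : 0 < 1 - ‖q‖ := by linarith
  refine ⟨?_, (1 - ‖q‖)⁻¹, fun z hz => ?_⟩
  · refine DifferentiableOn.inv (by fun_prop) fun z hz => ?_
    exact norm_pos_iff.1 (hpos.trans_le (hlow z (mem_ball_zero_iff.1 hz)))
  · rw [norm_inv]
    exact inv_anti₀ hpos (hlow z hz)

end HardySpace

/-! ### The linear fractional symbol -/

/-- If `q` is the reciprocal of the exterior fixed point (`0` if that point is `∞`), the fixed
points `ζ` and `1/q` give the normal form `w ∘ φ = w / a` with `w(z) = (1 - q z) / (1 - ζ̄ z)`,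
stated here without denominators. -/
theorem exists_normalForm {g : GL (Fin 2) ℂ} {ζ : ℂ} (hg : IsHyperbolicNonAutomorphism g ζ)
    {a : ℂ} (ha : HasDerivAt (linearFractional g) a ζ) :
    ∃ q : ℂ, ‖q‖ < 1 ∧ ∀ z : ℂ, ‖z‖ < 1 →
      a * (1 - q * linearFractional g z) * (1 - ζ⁻¹ * z) =
        (1 - q * z) * (1 - ζ⁻¹ * linearFractional g z) := by
  obtain ⟨hself, hζ, η, hη, hfix⟩ := hg
  have hζ0 : ζ ≠ 0 := by
    rintro rfl
    simp at hζ
  have h1 := (hfix ζ).2 (Or.inl rfl)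
  rw [OnePoint.smul_some_eq_ite] at h1
  have he1 : g 1 0 * ζ + g 1 1 ≠ 0 := by
    intro h
    rw [if_pos h] at h1
    exact OnePoint.infty_ne_coe _ h1
  rw [if_neg he1, OnePoint.coe_eq_coe, div_eq_iff he1] at h1
  have hda : a * (g 1 0 * ζ + g 1 1) ^ 2 =
      g 0 0 * (g 1 0 * ζ + g 1 1) - (g 0 0 * ζ + g 0 1) * g 1 0 := by
    have hn : HasDerivAt (fun z => g 0 0 * z + g 0 1) (g 0 0) ζ := by
      simpa using ((hasDerivAt_id ζ).const_mul (g 0 0)).add_const (g 0 1)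
    have hd : HasDerivAt (fun z => g 1 0 * z + g 1 1) (g 1 0) ζ := by
      simpa using ((hasDerivAt_id ζ).const_mul (g 1 0)).add_const (g 1 1)
    rw [ha.unique (hn.div hd he1)]
    field_simp
  have hspec : ∀ z : ℂ, ‖z‖ < 1 →
      linearFractional g z * (g 1 0 * z + g 1 1) = g 0 0 * z + g 0 1 := fun z hz =>
    div_mul_cancel₀ _ (hself z hz).1
  induction η using OnePoint.rec with
  | infty =>
    have h2 := (hfix OnePoint.infty).2 (Or.inr rfl)
    rw [OnePoint.smul_infty_eq_ite] at h2
    have hC : g 1 0 = 0 := by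
      by_contra h
      rw [if_neg h] at h2
      exact OnePoint.coe_ne_infty _ h2
    refine ⟨0, by simp, fun z hz => ?_⟩
    have h3 := hspec z hz
    simp only [hC, zero_mul, zero_add, mul_zero, sub_zero] at h1 h3 hda he1
    have h4 : a * g 1 1 = g 0 0 := mul_right_cancel₀ he1 (by linear_combination hda)
    field_simp
    refine mul_left_cancel₀ he1 ?_
    linear_combination (ζ - z) * h4 + h3 + h1
  | coe η =>
    have hη1 : 1 < ‖η‖ := by
      by_contra h
      exact hη ⟨η, by simpa using h, rfl⟩
    have hη0 : η ≠ 0 := norm_pos_iff.1 (one_pos.trans hη1)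
    have hne : ζ - η ≠ 0 := by
      intro h
      rw [← sub_eq_zero.1 h, hζ] at hη1
      exact lt_irrefl _ hη1
    have h2 := (hfix η).2 (Or.inr rfl)
    rw [OnePoint.smul_some_eq_ite] at h2
    have he2 : g 1 0 * η + g 1 1 ≠ 0 := by
      intro h
      rw [if_pos h] at h2
      exact OnePoint.infty_ne_coe _ h2
    rw [if_neg he2, OnePoint.coe_eq_coe, div_eq_iff he2] at h2
    have h5 : g 0 0 - g 1 0 * η = g 1 0 * ζ + g 1 1 :=
      mul_left_cancel₀ hne (by linear_combination h1 - h2)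
    have h6 : g 0 0 - g 1 0 * ζ = g 1 0 * η + g 1 1 :=
      mul_left_cancel₀ hne (by linear_combination h1 - h2)
    -- the derivative at a fixed point is the ratio of the eigenvalues of the matrix
    have h7 : a * (g 1 0 * ζ + g 1 1) = g 1 0 * η + g 1 1 := by
      refine mul_right_cancel₀ he1 ?_
      linear_combination hda + (g 1 0 * ζ + g 1 1) * h6 - g 1 0 * h1
    refine ⟨η⁻¹, by rw [norm_inv]; exact inv_lt_one_of_one_lt₀ hη1, fun z hz => ?_⟩
    have h3 := hspec z hz
    have hw := (hself z hz).1
    field_simp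
    refine mul_left_cancel₀ hw ?_
    have h8 : η * (g 1 0 * z + g 1 1) - (g 0 0 * z + g 0 1) = (g 1 0 * ζ + g 1 1) * (η - z) := by
      linear_combination (η - z) * h5 - h2
    have h9 : ζ * (g 1 0 * z + g 1 1) - (g 0 0 * z + g 0 1) = (g 1 0 * η + g 1 1) * (ζ - z) := by
      linear_combination (ζ - z) * h6 - h1
    rw [← h3] at h8 h9
    linear_combination a * (ζ - z) * h8 - (η - z) * h9 + (ζ - z) * (η - z) * h7

/-! ### The model of the composition operator on the half-line -/

namespace HalfLine

open MeasureTheory LaguerreBasis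

/-- The weight `exp (κ min(x, c))`. -/
noncomputable def capWeight (κ : ℂ) (c : ℝ) (x : ℝ) : ℂ := Complex.exp (κ * (min x c : ℝ))

theorem isBoundedWeight_capWeight (κ : ℂ) {c : ℝ} (hc : 0 ≤ c) :
    IsBoundedWeight (capWeight κ c) := by
  refine ⟨Continuous.measurable ?_, Real.exp (|κ.re| * c), fun x hx => ?_⟩
  · unfold capWeight
    fun_prop
  · rw [capWeight, Complex.norm_exp, Complex.re_mul_ofReal]
    refine Real.exp_le_exp.2 (mul_le_mul (le_abs_self _) (min_le_right _ _) (le_min hx.le hc)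
      (abs_nonneg _))

/-- Multiplication by `exp (-κ min(x, c))` on `L²(0, ∞)`. -/
noncomputable def capEquiv (κ : ℂ) {c : ℝ} (hc : 0 ≤ c) :
    Lp ℂ 2 halfLine ≃L[ℂ] Lp ℂ 2 halfLine :=
  have h : ∀ κ : ℂ, weightedDilation (isBoundedWeight_capWeight (-κ) hc) one_pos *
      weightedDilation (isBoundedWeight_capWeight κ hc) one_pos = 1 := fun κ => by
    rw [weightedDilation_mul]
    refine weightedDilation_eq_one _ _ (one_mul 1) fun x _ => ?_
    rw [one_mul, capWeight, capWeight, ← Complex.exp_add]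
    simp
  ContinuousLinearEquiv.equivOfInverse
    (weightedDilation (isBoundedWeight_capWeight (-κ) hc) one_pos)
    (weightedDilation (isBoundedWeight_capWeight κ hc) one_pos)
    (fun k => by
      have := h (-κ)
      simp only [neg_neg] at this
      exact DFunLike.congr_fun this k)
    (fun k => DFunLike.congr_fun (h κ) k)

theorem coeFn_capEquiv (κ : ℂ) {c : ℝ} (hc : 0 ≤ c) (k : Lp ℂ 2 halfLine) :
    capEquiv κ hc k =ᵐ[halfLine] fun x => Complex.exp (-κ * (min x c : ℝ)) * k x := by
  filter_upwards [coeFn_weightedDilation (isBoundedWeight_capWeight (-κ) hc) one_pos k] with x hx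
  rw [one_mul] at hx
  exact hx

end HalfLine

namespace HardySpace

open MeasureTheory LaguerreBasis HalfLine

/-- Multiplication by `1 - q z` after the rotation by `ζ⁻¹`. -/
noncomputable def fixedPointEquiv {ζ q : ℂ} (hζ : ‖ζ‖ = 1) (hq : ‖q‖ < 1) :
    HardySpace ≃L[ℂ] HardySpace :=
  have hζ0 : ζ ≠ 0 := norm_pos_iff.1 (hζ ▸ one_pos)
  have hqζ : ‖q * ζ‖ < 1 := by rwa [norm_mul, hζ, mul_one]
  weightedRotationEquiv (isMultiplier_one_sub_mul q) (isMultiplier_inv_one_sub_mul hqζ)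
    (ζ := ζ⁻¹) (ξ := ζ) (by rw [norm_inv, hζ, inv_one]) hζ (mul_inv_cancel₀ hζ0) fun z hz => by
      have h1 : q * ζ * (ζ⁻¹ * z) = q * z := by
        field_simp
      rw [h1]
      refine mul_inv_cancel₀ fun h => ?_
      have h2 : ‖q * z‖ = 1 := by rw [← sub_eq_zero.1 h, norm_one]
      rw [norm_mul] at h2
      nlinarith [norm_nonneg q, norm_nonneg z]

/-- The exponent `κ = (1 + q ζ) / (2 (1 - q ζ))`. -/
noncomputable def exponent (ζ q : ℂ) : ℂ := (1 + q * ζ) / (2 * (1 - q * ζ))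

theorem exponent_re_pos {ζ q : ℂ} (hζ : ‖ζ‖ = 1) (hq : ‖q‖ < 1) : 0 < (exponent ζ q).re := by
  have hp : ‖q * ζ‖ < 1 := by rwa [norm_mul, hζ, mul_one]
  set p := q * ζ with hpdef
  have hsq : p.re ^ 2 + p.im ^ 2 < 1 := by
    have := Complex.sq_norm p
    rw [Complex.normSq_apply] at this
    nlinarith [norm_nonneg p]
  have hne : 1 - p ≠ 0 := fun h => by
    rw [← sub_eq_zero.1 h, norm_one] at hp
    exact lt_irrefl _ hp
  have hns : 0 < Complex.normSq (2 * (1 - p)) :=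
    Complex.normSq_pos.2 (mul_ne_zero two_ne_zero hne)
  rw [exponent, ← hpdef, Complex.div_re, ← add_div]
  refine div_pos ?_ hns
  simp
  nlinarith

/-- The isomorphism from `L²(0, ∞)` onto `H²(𝔻)` that turns the composition operator with the
linear fractional symbol into a weighted dilation. -/
noncomputable def modelEquiv {ζ q : ℂ} (hζ : ‖ζ‖ = 1) (hq : ‖q‖ < 1) {c : ℝ} (hc : 0 ≤ c) :
    Lp ℂ 2 halfLine ≃L[ℂ] HardySpace :=
  ((capEquiv (exponent ζ q) hc).trans hardyLaplace.toContinuousLinearEquiv).trans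
    (fixedPointEquiv hζ hq)

theorem modelEquiv_apply {ζ q : ℂ} (hζ : ‖ζ‖ = 1) (hq : ‖q‖ < 1) {c : ℝ} (hc : 0 ≤ c)
    (k : Lp ℂ 2 halfLine) {z : ℂ} (hz : ‖z‖ < 1) :
    modelEquiv hζ hq hc k z = (1 - q * z) * (1 - ζ⁻¹ * z)⁻¹ *
      ∫ x, k x * Complex.exp (-exponent ζ q * (min x c : ℝ) - x * ((1 - ζ⁻¹ * z)⁻¹ - 1 / 2))
        ∂halfLine := by
  have hz' : ‖ζ⁻¹ * z‖ < 1 := by simpa [hζ] using hz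
  have h1 : modelEquiv hζ hq hc k z =
      (1 - q * z) * hardyLaplace (capEquiv (exponent ζ q) hc k) (ζ⁻¹ * z) := rfl
  rw [h1, hardyLaplace_apply _ hz', mul_assoc]
  congr 2
  refine integral_congr_ae ?_
  filter_upwards [coeFn_capEquiv (exponent ζ q) hc k] with x hx
  rw [hx, sub_eq_add_neg (-exponent ζ q * _), Complex.exp_add, neg_mul_eq_neg_mul]
  ring

/-- Composition with a map in the normal form `w ∘ φ = w / a` is, in the model, the dilation by
`a` with the weight `levelWeight`. -/
theorem modelEquiv_comp {ζ q : ℂ} (hζ : ‖ζ‖ = 1) (hq : ‖q‖ < 1) {c : ℝ} (hc : 0 ≤ c) {a : ℝ}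
    (ha0 : 0 < a) (ha1 : a < 1) (k : Lp ℂ 2 halfLine) {z z' : ℂ} (hz : ‖z‖ < 1) (hz' : ‖z'‖ < 1)
    (h : a * (1 - q * z') * (1 - ζ⁻¹ * z) = (1 - q * z) * (1 - ζ⁻¹ * z')) :
    modelEquiv hζ hq hc k z' =
      modelEquiv hζ hq hc (levelDilation (exponent_re_pos hζ hq) ha0 ha1 c k) z := by
  have hζ0 : ζ ≠ 0 := norm_pos_iff.1 (hζ ▸ one_pos)
  have hne : ∀ {p y : ℂ}, ‖p‖ ≤ 1 → ‖y‖ < 1 → 1 - p * y ≠ 0 := fun {p y} hp hy h0 => by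
    have h2 : ‖p * y‖ = 1 := by rw [← sub_eq_zero.1 h0, norm_one]
    rw [norm_mul] at h2
    nlinarith [norm_nonneg p, norm_nonneg y]
  have hζi : ‖ζ⁻¹‖ ≤ 1 := by rw [norm_inv, hζ, inv_one]
  have h1 := hne hζi hz
  have h2 := hne hζi hz'
  have h3 : 1 - q * ζ ≠ 0 := by
    intro h0
    have : ‖q * ζ‖ = 1 := by rw [← sub_eq_zero.1 h0, norm_one]
    rw [norm_mul, hζ, mul_one] at this
    exact hq.ne this
  have ha : (a : ℂ) ≠ 0 := by exact_mod_cast ha0.ne'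
  set κ := exponent ζ q with hκ
  -- `w` is affine in `W = 1 / (1 - ζ⁻¹ z) - 1/2`, with zero at `W = -κ`
  have hWκ : ∀ {y : ℂ}, 1 - ζ⁻¹ * y ≠ 0 → (1 - ζ⁻¹ * y)⁻¹ - 1 / 2 + κ =
      (1 - q * y) * (1 - ζ⁻¹ * y)⁻¹ * (1 - q * ζ)⁻¹ := fun {y} hy => by
    have h3' : 1 - ζ * q ≠ 0 := by rwa [mul_comm]
    rw [hκ, exponent]
    field_simp
    have hy' : ζ - y ≠ 0 := fun h0 => hy (by rw [← sub_eq_zero.1 h0, inv_mul_cancel₀ hζ0, sub_self])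
    field_simp
    ring
  have hm : (1 - q * z') * (1 - ζ⁻¹ * z')⁻¹ * a = (1 - q * z) * (1 - ζ⁻¹ * z)⁻¹ := by
    rw [mul_right_comm, ← div_eq_mul_inv, ← div_eq_mul_inv, div_eq_div_iff h2 h1, ← h]
    ring
  have hW : a * ((1 - ζ⁻¹ * z')⁻¹ - 1 / 2) = (1 - ζ⁻¹ * z)⁻¹ - 1 / 2 + κ - a * κ := by
    rw [hWκ h1, ← hm]
    linear_combination a * hWκ h2
  rw [modelEquiv_apply hζ hq hc _ hz, modelEquiv_apply hζ hq hc _ hz', ← hm, mul_assoc _ (a : ℂ)]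
  congr 1
  set F : ℝ → ℂ := fun x =>
    k x * Complex.exp (-κ * (min x c : ℝ) - x * ((1 - ζ⁻¹ * z')⁻¹ - 1 / 2)) with hF
  have hint := HalfLine.integral_comp_mul_left ha0 F
  have hint' : ∫ x, F x ∂halfLine = a * ∫ x, F (a * x) ∂halfLine := by
    rw [hint, ← mul_assoc, mul_inv_cancel₀ ha, one_mul]
  rw [hint']
  congr 1
  refine integral_congr_ae ?_
  filter_upwards [coeFn_weightedDilation
    (isBoundedWeight_levelWeight (exponent_re_pos hζ hq) ha1 c) ha0 k] with x hx
  rw [levelDilation, hx, hF, levelWeight, mul_comm _ (k (a * x)), mul_assoc, ← Complex.exp_add]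
  refine congrArg (fun t => k (a * x) * Complex.exp t) ?_
  have hmin : ∀ y : ℝ, ((max (y - c) 0 : ℝ) : ℂ) = y - (min y c : ℝ) := fun y => by
    rw [← Complex.ofReal_sub]
    congr 1
    rcases le_total y c with hy | hy
    · rw [max_eq_right (by linarith), min_eq_left hy, sub_self]
    · rw [max_eq_left (by linarith), min_eq_right hy]
  rw [Complex.ofReal_sub, hmin, hmin, ← hκ]
  push_cast
  linear_combination -(x : ℂ) * hW

end HardySpace

open HardySpace HalfLine in
theorem mainTheorem4 (g : GL (Fin 2) ℂ) (ζ : ℂ) (hg : IsHyperbolicNonAutomorphism g ζ)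
    (a : ℝ) (ha0 : 0 < a) (ha1 : a < 1)
    (ha : HasDerivAt (linearFractional g) (a : ℂ) ζ) :
    ∃ C : HardySpace →L[ℂ] HardySpace, IsCompositionOperator (linearFractional g) C ∧
      ∀ lam : ℂ, 0 < ‖lam‖ → ‖lam‖ < a ^ (-(1 / 2) : ℝ) →
        IsUniversalOperator (C - lam • ContinuousLinearMap.id ℂ HardySpace) := by
  obtain ⟨q, hq, hform⟩ := exists_normalForm hg ha
  obtain ⟨hself, hζ, -⟩ := hg
  have hκ := exponent_re_pos hζ hq
  let G := fun {c : ℝ} (hc : 0 ≤ c) => modelEquiv hζ hq hc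
  let D := levelDilation hκ ha0 ha1
  have hcomp : ∀ {c : ℝ} (hc : 0 ≤ c) k z, ‖z‖ < 1 →
      G hc (D c k) z = G hc k (linearFractional g z) := fun hc k z hz =>
    (modelEquiv_comp hζ hq hc ha0 ha1 k hz (hself z hz).2 (hform z hz)).symm
  let C : HardySpace →L[ℂ] HardySpace :=
    (G le_rfl : _ →L[ℂ] HardySpace) ∘L D 0 ∘L ((G le_rfl).symm : HardySpace →L[ℂ] _)
  have hC : IsCompositionOperator (linearFractional g) C := fun f z hz => by
    have h1 := hcomp le_rfl ((G le_rfl).symm f) z hz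
    rw [ContinuousLinearEquiv.apply_symm_apply] at h1
    exact h1
  refine ⟨C, hC, fun l hl0 hl => ?_⟩
  obtain ⟨c, hc, W, V, J, hAV, hAW, hJV, hJW⟩ := exists_level_rightInverse hκ ha0 ha1 hl0 hl
  have hCG : ∀ k, C (G hc.le k) = G hc.le (D c k) := fun k => ext_disc fun z hz => by
    rw [hC _ z hz, hcomp hc.le k z hz]
  let e : lp (fun _ : ℕ => ℂ) 2 ≃L[ℂ] HardySpace := coeffEquiv.toContinuousLinearEquiv
  refine isUniversalOperator_of_similar (A := D c - l • 1) (W := W)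
    (V := V ∘L (e.symm : HardySpace →L[ℂ] _)) (J := (e : _ →L[ℂ] HardySpace) ∘L J)
    (G hc.le) (fun k => ?_) ?_ hAW ?_ ?_
  · change C (G hc.le k) - l • G hc.le k = G hc.le (D c k - l • k)
    rw [hCG, map_sub, map_smul]
  · rw [← ContinuousLinearMap.comp_assoc, hAV, ContinuousLinearMap.zero_comp]
  · ext1 f
    have h1 : J (V (e.symm f)) = e.symm f := DFunLike.congr_fun hJV _
    simp [h1]
  · rw [ContinuousLinearMap.comp_assoc, hJW, ContinuousLinearMap.comp_zero]
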